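/- Two nodes of $\mathbb{Z}^2$ are called adjacent if their Euclidean distance is $1$, and $*$adjacent if it is $1$ or $\sqrt2$. For a configuration in $\{0,1\}^{\mathbb{Z}^2}$, a $0$cluster is a (non-empty) maximal connected set of nodes with spin $0$, and a $1*$cluster is a (non-empty) maximal $*$connected set of nodes with spin $1$. A probability measure $\mu$ on $\{0,1\}^{\mathbb{Z}^2}$ is positively associated if $\mu(A\cap B)\ge\mu(A)\mu(B)$ for all increasing events $A,B$. On the event that there exist a single infinite $0$cluster and a single infinite $1*$cluster, the infinite boundary is defined as follows: fill the finite holes of the infinite $1*$cluster (that is, add to it all finite connected components of its complement in $\mathbb{Z}^2$), let each node of the filled cluster be the centre of an axis-parallel square with side length $3/2$, and take the topological boundary in $\mathbb{R}^2$ of the union of these squares. This event is the event that the infinite boundary exists. Theorem. There exists no probability measure $\mu'$ on $\{0,1\}^{\mathbb{Z}^2}$ which possesses all of the following properties: (i) $\mu'$ is positively associated; (ii) $\mu'$-almost surely there exists a single infinite $0$cluster; (iii) $\mu'$-almost surely there exists at most one infinite $1*$cluster; (iv') the distribution of the infinite boundary (as a random closed subset of $\mathbb{R}^2$), conditioned on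 its existence, is invariant under translations by vectors of $\mathbb{Z}^2$; (v') with positive probability there exists an infinite $1*$cluster. -/

import Mathlib

open MeasureTheory ProbabilityTheory TopologicalSpace

namespace SitePercolation

/-- A node of the square lattice `ℤ²`. -/
abbrev Node : Type := ℤ × ℤ

/-- A spin configuration in `{0,1}^{ℤ²}`, with the pointwise order and the product σ-algebra. -/
abbrev Config : Type := Node → Fin 2

/-- The square of the Euclidean distance of two nodes. -/
def sqDist (x y : Node) : ℤ := (x.1 - y.1) ^ 2 + (x.2 - y.2) ^ 2

theorem sqDist_comm (x y : Node) : sqDist x y = sqDist y x := by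
  unfold sqDist; ring

theorem sqDist_self (x : Node) : sqDist x x = 0 := by
  simp [sqDist]

/-- Adjacency on `ℤ²`: Euclidean distance `1`. -/
def latticeGraph : SimpleGraph Node where
  Adj x y := sqDist x y = 1
  symm := ⟨fun x y h => by rwa [sqDist_comm y x]⟩
  loopless := ⟨fun x h => by simp [sqDist_self] at h⟩

/-- `*`adjacency on `ℤ²`: Euclidean distance `1` or `√2`. -/
def starGraph : SimpleGraph Node where
  Adj x y := sqDist x y = 1 ∨ sqDist x y = 2
  symm := ⟨fun x y h => by rwa [sqDist_comm y x]⟩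
  loopless := ⟨fun x h => by simp [sqDist_self] at h⟩

/-- There is a self-avoiding path of `G` from `x` to `y` all of whose nodes belong to `A`. -/
def ConnectedIn (G : SimpleGraph Node) (A : Set Node) (x y : Node) : Prop :=
  ∃ p : G.Walk x y, p.IsPath ∧ ∀ z ∈ p.support, z ∈ A

/-- `S` is a cluster of spin `s` for the adjacency `G`: a (non-empty) maximal `G`-connected set of
nodes that carry the spin `s`. -/
structure IsCluster (G : SimpleGraph Node) (s : Fin 2) (σ : Config) (S : Set Node) : Prop where
  nonempty : S.Nonempty
  spin : ∀ x ∈ S, σ x = s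
  connected : ∀ x ∈ S, ∀ y ∈ S, ConnectedIn G S x y
  maximal : ∀ z ∉ S, ∀ y ∈ S, ¬ ConnectedIn G {x | σ x = s} z y

/-- `S` is an infinite `0`cluster of `σ`. -/
def IsInfiniteZeroCluster (σ : Config) (S : Set Node) : Prop :=
  IsCluster latticeGraph 0 σ S ∧ S.Infinite

/-- `S` is an infinite `1*`cluster of `σ`. -/
def IsInfiniteOneStarCluster (σ : Config) (S : Set Node) : Prop :=
  IsCluster starGraph 1 σ S ∧ S.Infinite

/-- Positive association: increasing events are nonnegatively correlated. -/
def PositivelyAssociated (μ : Measure Config) : Prop :=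
  ∀ A B : Set Config, MeasurableSet A → MeasurableSet B → IsUpperSet A → IsUpperSet B →
    μ A * μ B ≤ μ (A ∩ B)

/-- The event that a single infinite `0`cluster and a single infinite `1*`cluster exist. -/
def coexistence : Set Config :=
  {σ | (∃! S, IsInfiniteZeroCluster σ S) ∧ (∃! S, IsInfiniteOneStarCluster σ S)}

/-- The union of all infinite `1*`clusters; on `coexistence` this is the infinite `1*`cluster. -/
def infiniteOneStarCluster (σ : Config) : Set Node :=
  ⋃₀ {S | IsInfiniteOneStarCluster σ S}

/-- The set `C` with its finite holes filled, a hole being a connected component (for ordinary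
adjacency) of the complement of `C`; the finite ones are those that are `*`encircled by `C`. -/
def fillHoles (C : Set Node) : Set Node :=
  C ∪ {x | x ∉ C ∧ {y | ConnectedIn latticeGraph Cᶜ x y}.Finite}

/-- The closed axis-parallel square with centre `x` and side length `3/2`. -/
def square (x : Node) : Set (ℝ × ℝ) :=
  Set.Icc ((x.1 : ℝ) - 3 / 4) ((x.1 : ℝ) + 3 / 4) ×ˢ
    Set.Icc ((x.2 : ℝ) - 3 / 4) ((x.2 : ℝ) + 3 / 4)

/-- The infinite boundary: the topological boundary of the union of the squares that are centred at
the nodes of the filled infinite `1*`cluster. It is meant on `coexistence` only. -/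
def infiniteBoundary (σ : Config) : Closeds (ℝ × ℝ) :=
  ⟨frontier (⋃ x ∈ fillHoles (infiniteOneStarCluster σ), square x), isClosed_frontier⟩

/-- The usual σ-algebra on the closed subsets of the plane (Effros, Fell), generated by the events
that the closed set hits a given open set. -/
@[reducible]
def closedSetsSigma : MeasurableSpace (Closeds (ℝ × ℝ)) :=
  MeasurableSpace.generateFrom
    {𝒜 | ∃ U : Set (ℝ × ℝ), IsOpen U ∧
      𝒜 = {F : Closeds (ℝ × ℝ) | ((F : Set (ℝ × ℝ)) ∩ U).Nonempty}}

/-- The translate `F + v` of a closed set `F` by a lattice vector `v`. -/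
def translate (v : Node) (F : Closeds (ℝ × ℝ)) : Closeds (ℝ × ℝ) :=
  ⟨(fun p : ℝ × ℝ => p + ((v.1 : ℝ), (v.2 : ℝ))) '' (F : Set (ℝ × ℝ)),
    (Homeomorph.addRight ((v.1 : ℝ), (v.2 : ℝ))).isClosedMap _ F.isClosed⟩

/-- The distribution of the infinite boundary, conditioned on its existence (that is, on
`coexistence`), is invariant under the translations by lattice vectors: the infinite boundary and
each of its translates have the same conditional distribution. -/
def BoundaryLawTranslationInvariant (μ : Measure Config) : Prop :=
  ∀ (v : Node) (𝒜 : Set (Closeds (ℝ × ℝ))), MeasurableSet[closedSetsSigma] 𝒜 →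
    μ[|coexistence] {σ | translate v (infiniteBoundary σ) ∈ 𝒜} =
      μ[|coexistence] {σ | infiniteBoundary σ ∈ 𝒜}

end SitePercolation

open SitePercolation

/-! A measure with the listed properties leads to a contradiction as follows.

Write `C` for the infinite `1*`cluster and `W` for the filled cluster. The boundary of the union of
the squares around the nodes of `W` determines `W`: since the side length `3/2` is not an integer, it
also shows on which side `W` lies (`decode_frontier`). So, conditionally on coexistence, `W` is a stationary
random set. The nodes of `W` next to its complement belong to `C`, and the nodes of the complement
next to `W` belong to the infinite `0`cluster (`escapes_of_boundary`). Therefore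

* every node belongs to `C` with probability at least some `δ > 0`;
* every box of a large fixed size meets the infinite `0`cluster with probability close to `1`,
  conditionally by stationarity, and then also unconditionally by positive association;
* removing a box from `W` is unlikely to cut off from infinity a node of `W` that is far from the
  box, uniformly in the position of the box (`exists_radius_cutOff`).

Now fix two nodes `a` and `b` far apart in the same row; by positive association both belong to `C`
with probability at least `δ²`. Infinite `0`paths from a box far from `a` and `b` are classified by
the parity of the number of times that they cross the segment from `a` to `b`. By positive
association (the square root trick), for every box one of the two parities occurs with probability
close to `1`. On the event that both parities occur for the same box, or for two neighbouring boxes,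
while `a` and `b` belong to `C` and are not cut off by the box, there is a contradiction to the
uniqueness of the infinite clusters (`Coexists.not_both_parities`). So the likely parity is unique
for every box and the same for neighbouring boxes. But a box that is moved once around `a` passes the
segment once, which changes the parity (`not_consistent_parity`).

Planar topology enters through cochains modulo two on the edges of the lattice: the rays from the two
ends of a `*`walk differ by a coboundary off this walk (`exists_potential`), and a cochain that
vanishes on all unit squares is a coboundary (`exists_primitive`), which yields the connectedness of
outer boundaries (`linked_outer_boundary`).
-/

namespace SitePercolation

/-! ### Walks and boxes in the square lattice -/

theorem latticeGraph_adj_iff {x y : Node} :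
    latticeGraph.Adj x y ↔
      (x.2 = y.2 ∧ (y.1 = x.1 + 1 ∨ x.1 = y.1 + 1)) ∨
        (x.1 = y.1 ∧ (y.2 = x.2 + 1 ∨ x.2 = y.2 + 1)) := by
  obtain ⟨a, b⟩ := x
  obtain ⟨c, d⟩ := y
  change (a - c) ^ 2 + (b - d) ^ 2 = 1 ↔ _
  constructor
  · intro h
    have h1 : -1 ≤ a - c := by nlinarith [sq_nonneg (b - d)]
    have h2 : a - c ≤ 1 := by nlinarith [sq_nonneg (b - d)]
    have h3 : -1 ≤ b - d := by nlinarith [sq_nonneg (a - c)]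
    have h4 : b - d ≤ 1 := by nlinarith [sq_nonneg (a - c)]
    generalize hu : a - c = u at *
    generalize hv : b - d = v at *
    interval_cases u <;> interval_cases v <;> simp_all <;> omega
  · rintro (⟨h, h' | h'⟩ | ⟨h, h' | h'⟩) <;> simp only at h h' <;> subst h <;> subst h' <;> ring

theorem starGraph_adj_iff {x y : Node} :
    starGraph.Adj x y ↔
      ¬ (x.1 = y.1 ∧ x.2 = y.2) ∧ |x.1 - y.1| ≤ 1 ∧ |x.2 - y.2| ≤ 1 := by
  obtain ⟨a, b⟩ := x
  obtain ⟨c, d⟩ := y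
  change (a - c) ^ 2 + (b - d) ^ 2 = 1 ∨ (a - c) ^ 2 + (b - d) ^ 2 = 2 ↔ _
  simp only [abs_le]
  constructor
  · intro h
    have h0 : (a - c) ^ 2 + (b - d) ^ 2 ≤ 2 := by rcases h with h | h <;> omega
    refine ⟨?_, ⟨?_, ?_⟩, ?_, ?_⟩
    · rintro ⟨rfl, rfl⟩
      simp at h
    all_goals nlinarith [sq_nonneg (b - d), sq_nonneg (a - c)]
  · rintro ⟨h, ⟨h1, h2⟩, h3, h4⟩
    have h' : ¬ (a - c = 0 ∧ b - d = 0) := by omega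
    generalize a - c = u at *
    generalize b - d = v at *
    interval_cases u <;> interval_cases v <;> simp_all

theorem starGraph_adj_of_latticeGraph_adj {x y : Node} (h : latticeGraph.Adj x y) :
    starGraph.Adj x y := Or.inl h

/-- `x` and `y` are joined by a walk of `G` whose nodes all belong to `A`. The empty walk is allowed
at every node, whether it belongs to `A` or not. -/
def Linked (G : SimpleGraph Node) (A : Set Node) : Node → Node → Prop :=
  Relation.ReflTransGen fun u v => G.Adj u v ∧ u ∈ A ∧ v ∈ A

namespace Linked

variable {G : SimpleGraph Node} {A B : Set Node} {x y z : Node}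

theorem refl (x : Node) : Linked G A x x := Relation.ReflTransGen.refl

theorem trans (h : Linked G A x y) (h' : Linked G A y z) : Linked G A x z :=
  Relation.ReflTransGen.trans h h'

theorem step (h : G.Adj x y) (hx : x ∈ A) (hy : y ∈ A) : Linked G A x y :=
  Relation.ReflTransGen.single ⟨h, hx, hy⟩

theorem symm (h : Linked G A x y) : Linked G A y x := by
  induction h with
  | refl => exact refl _
  | tail _ h ih => exact (step h.1.symm h.2.2 h.2.1).trans ih

theorem mono (hAB : A ⊆ B) (h : Linked G A x y) : Linked G B x y :=
  Relation.ReflTransGen.mono (fun _ _ h => ⟨h.1, hAB h.2.1, hAB h.2.2⟩) _ _ h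

theorem mem_of_mem (h : Linked G A x y) (hx : x ∈ A) : y ∈ A := by
  cases h with
  | refl => exact hx
  | tail _ h => exact h.2.2

theorem toStar (h : Linked latticeGraph A x y) : Linked starGraph A x y :=
  Relation.ReflTransGen.mono (fun _ _ h => ⟨starGraph_adj_of_latticeGraph_adj h.1, h.2⟩) _ _ h

/-- A function that is constant along the edges of `A` is constant along walks in `A`. -/
theorem apply_eq {β : Type*} (f : Node → β)
    (hf : ∀ u v, G.Adj u v → u ∈ A → v ∈ A → f u = f v) (h : Linked G A x y) : f x = f y := by
  induction h with
  | refl => rfl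
  | tail _ h ih => exact ih.trans (hf _ _ h.1 h.2.1 h.2.2)

/-- A walk that leaves `B` has a first step out of `B`. -/
theorem exists_exit (h : Linked G A x y) (hx : x ∈ B) (hy : y ∉ B) :
    ∃ u v, Linked G (A ∩ B) x u ∧ G.Adj u v ∧ u ∈ A ∧ v ∈ A ∧ u ∈ B ∧ v ∉ B := by
  have key : (Linked G (A ∩ B) x y ∧ y ∈ B) ∨
      ∃ u v, Linked G (A ∩ B) x u ∧ G.Adj u v ∧ u ∈ A ∧ v ∈ A ∧ u ∈ B ∧ v ∉ B := by
    clear hy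
    induction h with
    | refl => exact Or.inl ⟨refl _, hx⟩
    | @tail b c _ h ih =>
      rcases ih with ⟨ih, hb⟩ | ih
      · by_cases hc : c ∈ B
        · exact Or.inl ⟨ih.trans (step h.1 ⟨h.2.1, hb⟩ ⟨h.2.2, hc⟩), hc⟩
        · exact Or.inr ⟨b, c, ih, h.1, h.2.1, h.2.2, hb, hc⟩
      · exact Or.inr ih
  rcases key with h | h
  · exact absurd h.2 hy
  · exact h

end Linked

theorem connectedIn_iff {G : SimpleGraph Node} {A : Set Node} {x y : Node} :
    ConnectedIn G A x y ↔ x ∈ A ∧ Linked G A x y := by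
  classical
  constructor
  · rintro ⟨p, -, hp⟩
    refine ⟨hp _ p.start_mem_support, ?_⟩
    induction p with
    | nil => exact Linked.refl _
    | cons h p ih =>
      refine (Linked.step h (hp _ (by simp)) (hp _ (by simp))).trans (ih ?_)
      intro z hz
      exact hp z (by simp [hz])
  · rintro ⟨hx, h⟩
    suffices h : ∃ p : G.Walk x y, ∀ z ∈ p.support, z ∈ A by
      obtain ⟨p, hp⟩ := h
      exact ⟨p.bypass, p.bypass_isPath, fun z hz => hp z (p.support_bypass_subset_support hz)⟩
    induction h with
    | refl => exact ⟨.nil, by simpa using hx⟩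
    | tail _ h ih =>
      obtain ⟨p, hp⟩ := ih
      refine ⟨p.concat h.1, fun z hz => ?_⟩
      rw [SimpleGraph.Walk.support_concat] at hz
      simp only [List.mem_append, List.mem_singleton] at hz
      rcases hz with hz | rfl
      · exact hp z hz
      · exact h.2.2

/-- The square box of side length `2 r` centred at `c`. -/
def box (c : Node) (r : ℕ) : Set Node :=
  {x | c.1 - r ≤ x.1 ∧ x.1 ≤ c.1 + r ∧ c.2 - r ≤ x.2 ∧ x.2 ≤ c.2 + r}

theorem mem_box {c x : Node} {r : ℕ} :
    x ∈ box c r ↔ c.1 - r ≤ x.1 ∧ x.1 ≤ c.1 + r ∧ c.2 - r ≤ x.2 ∧ x.2 ≤ c.2 + r := Iff.rfl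

theorem finite_box (c : Node) (r : ℕ) : (box c r).Finite := by
  refine ((Set.finite_Icc (c.1 - r) (c.1 + r)).prod (Set.finite_Icc (c.2 - r) (c.2 + r))).subset ?_
  rintro x ⟨h1, h2, h3, h4⟩
  exact ⟨⟨h1, h2⟩, h3, h4⟩

theorem box_mono (c : Node) {r s : ℕ} (h : r ≤ s) : box c r ⊆ box c s := by
  intro x hx
  rw [mem_box] at hx ⊢
  omega

theorem exists_mem_box (x : Node) : ∃ r, x ∈ box 0 r :=
  ⟨x.1.natAbs + x.2.natAbs, by simp only [mem_box, Prod.fst_zero, Prod.snd_zero]; omega⟩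

theorem exists_subset_box {A : Set Node} (hA : A.Finite) : ∃ r, A ⊆ box 0 r := by
  induction A, hA using Set.Finite.induction_on with
  | empty => exact ⟨0, by simp⟩
  | @insert a s _ _ ih =>
    obtain ⟨r, hr⟩ := ih
    obtain ⟨t, ht⟩ := exists_mem_box a
    refine ⟨r + t, Set.insert_subset (box_mono 0 (by omega) ht) (hr.trans (box_mono 0 (by omega)))⟩

theorem linked_horizontal {A : Set Node} {a b y : ℤ}
    (h : ∀ t, min a b ≤ t → t ≤ max a b → (t, y) ∈ A) : Linked latticeGraph A (a, y) (b, y) := by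
  wlog hab : a ≤ b generalizing a b
  · exact (this (fun t h1 h2 => h t (by rwa [min_comm]) (by rwa [max_comm])) (by omega)).symm
  obtain ⟨k, rfl⟩ := Int.le.dest hab
  clear hab
  induction k with
  | zero => simpa using Linked.refl _
  | succ k ih =>
    push_cast at h ⊢
    refine (ih fun t h1 h2 => h t (by omega) (by omega)).trans (Linked.step ?_ ?_ ?_)
    · rw [latticeGraph_adj_iff]
      simp [add_assoc]
    · exact h _ (by omega) (by omega)
    · exact h _ (by omega) (by omega)

theorem linked_vertical {A : Set Node} {a b x : ℤ}
    (h : ∀ t, min a b ≤ t → t ≤ max a b → (x, t) ∈ A) : Linked latticeGraph A (x, a) (x, b) := by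
  wlog hab : a ≤ b generalizing a b
  · exact (this (fun t h1 h2 => h t (by rwa [min_comm]) (by rwa [max_comm])) (by omega)).symm
  obtain ⟨k, rfl⟩ := Int.le.dest hab
  clear hab
  induction k with
  | zero => simpa using Linked.refl _
  | succ k ih =>
    push_cast at h ⊢
    refine (ih fun t h1 h2 => h t (by omega) (by omega)).trans (Linked.step ?_ ?_ ?_)
    · rw [latticeGraph_adj_iff]
      simp [add_assoc]
    · exact h _ (by omega) (by omega)
    · exact h _ (by omega) (by omega)

theorem linked_box {c x y : Node} {r : ℕ} (hx : x ∈ box c r) (hy : y ∈ box c r) :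
    Linked latticeGraph (box c r) x y := by
  obtain ⟨a, b⟩ := x
  obtain ⟨a', b'⟩ := y
  rw [mem_box] at hx hy
  simp only at hx hy
  refine (linked_horizontal (b := a') fun t h1 h2 => ?_).trans
    (linked_vertical fun t h1 h2 => ?_) <;> rw [mem_box] <;> simp only <;> omega

theorem linked_univ (x y : Node) : Linked latticeGraph Set.univ x y :=
  (linked_horizontal (a := x.1) (b := y.1) (y := x.2) fun _ _ _ => Set.mem_univ _).trans
    (linked_vertical (a := x.2) (b := y.2) (x := y.1) fun _ _ _ => Set.mem_univ _)

/-- The complement of a box is connected. -/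
theorem linked_compl_box {c x y : Node} {r : ℕ} (hx : x ∉ box c r) (hy : y ∉ box c r) :
    Linked latticeGraph (box c r)ᶜ x y := by
  suffices h : ∀ x ∉ box c r, Linked latticeGraph (box c r)ᶜ x (c.1 + r + 1, c.2 + r + 1) from
    (h x hx).trans (h y hy).symm
  clear hx hy x y
  rintro ⟨a, b⟩ hx
  rw [mem_box] at hx
  simp only at hx
  by_cases ha : c.1 - r ≤ a ∧ a ≤ c.1 + r
  · refine (linked_horizontal (b := c.1 + r + 1) fun t h1 h2 => ?_).trans
      (linked_vertical fun t h1 h2 => ?_) <;> rw [Set.mem_compl_iff, mem_box] <;> simp only <;> omega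
  · refine (linked_vertical (b := c.2 + r + 1) fun t h1 h2 => ?_).trans
      (linked_horizontal fun t h1 h2 => ?_) <;> rw [Set.mem_compl_iff, mem_box] <;> simp only <;> omega

/-- `x` belongs to `A` and walks of `G` in `A` lead from `x` out of every box. -/
def Escapes (G : SimpleGraph Node) (A : Set Node) (x : Node) : Prop :=
  x ∈ A ∧ ∀ r : ℕ, ∃ u, u ∉ box 0 r ∧ Linked G A x u

theorem escapes_iff_infinite {G : SimpleGraph Node} {A : Set Node} {x : Node} (hx : x ∈ A) :
    Escapes G A x ↔ {y | Linked G A x y}.Infinite := by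
  constructor
  · rintro ⟨-, h⟩ hfin
    obtain ⟨r, hr⟩ := exists_subset_box hfin
    obtain ⟨u, hu, hxu⟩ := h r
    exact hu (hr hxu)
  · intro h
    refine ⟨hx, fun r => ?_⟩
    by_contra! hc
    exact h ((finite_box 0 r).subset fun y hy => by_contra fun hyr => hc y hyr hy)

theorem Escapes.of_linked {G : SimpleGraph Node} {A : Set Node} {x y : Node} (hx : Escapes G A x)
    (h : Linked G A x y) : Escapes G A y :=
  ⟨h.mem_of_mem hx.1, fun r => let ⟨u, hu, hxu⟩ := hx.2 r; ⟨u, hu, h.symm.trans hxu⟩⟩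

theorem Escapes.mono {G : SimpleGraph Node} {A B : Set Node} {x : Node} (hAB : A ⊆ B)
    (hx : Escapes G A x) : Escapes G B x :=
  ⟨hAB hx.1, fun r => let ⟨u, hu, hxu⟩ := hx.2 r; ⟨u, hu, hxu.mono hAB⟩⟩

/-! ### Cochains modulo two -/

/-- The edges of the square lattice that are crossed by a horizontal ray which starts at `a` and
runs to the right, slightly above the row of `a`: the value is `1` on these edges and `0`
elsewhere. -/
def rayCochain (a u v : Node) : ZMod 2 :=
  open Classical in
  if u.1 = v.1 ∧ a.1 ≤ u.1 ∧ ((u.2 = a.2 ∧ v.2 = a.2 + 1) ∨ (v.2 = a.2 ∧ u.2 = a.2 + 1)) then 1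
  else 0

theorem zmod_two_add_self (i : ZMod 2) : i + i = 0 := CharTwo.add_self_eq_zero i

/-- The rays from the two ends of a `*`edge differ by a coboundary off these ends. -/
theorem exists_potential_step {b c : Node} (h : starGraph.Adj b c) :
    ∃ f : Node → ZMod 2, ∀ u v, latticeGraph.Adj u v → u ≠ b → v ≠ b → u ≠ c → v ≠ c →
      f u + f v = rayCochain b u v + rayCochain c u v := by
  classical
  wlog hbc : b.2 ≤ c.2 generalizing b c
  · obtain ⟨f, hf⟩ := this h.symm (by omega)
    exact ⟨f, fun u v huv h1 h2 h3 h4 => by rw [hf u v huv h3 h4 h1 h2, add_comm]⟩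
  rw [starGraph_adj_iff, abs_le, abs_le] at h
  rcases hbc.eq_or_lt with hbc | hbc
  · refine ⟨0, fun u v huv h1 h2 h3 h4 => ?_⟩
    rw [latticeGraph_adj_iff] at huv
    rw [Ne, Prod.ext_iff] at h1 h2 h3 h4
    have : rayCochain b u v = rayCochain c u v := by
      unfold rayCochain
      congr 1
      apply propext
      omega
    rw [this, zmod_two_add_self]
    rfl
  · -- the part of the row of `c` to the right of `c` lies between the two rays
    refine ⟨fun u => if u.2 = c.2 ∧ c.1 ≤ u.1 then 1 else 0, fun u v huv h1 h2 h3 h4 => ?_⟩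
    rw [latticeGraph_adj_iff] at huv
    rw [Ne, Prod.ext_iff] at h1 h2 h3 h4
    unfold rayCochain
    simp only
    split_ifs <;> first | rfl | (exfalso; omega)

/-- Off a `*`walk from `a` to `b`, the rays from `a` and from `b` differ by a coboundary. So a closed
walk of the lattice that avoids the `*`walk crosses the two rays equally often modulo two. -/
theorem exists_potential {A : Set Node} {a b : Node} (h : Linked starGraph A a b) :
    ∃ f : Node → ZMod 2, ∀ u v, latticeGraph.Adj u v → u ∉ A → v ∉ A →
      f u + f v = rayCochain a u v + rayCochain b u v := by
  induction h with
  | refl => exact ⟨0, fun u v _ _ _ => by rw [zmod_two_add_self]; rfl⟩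
  | @tail b c _ h ih =>
    obtain ⟨f, hf⟩ := ih
    obtain ⟨g, hg⟩ := exists_potential_step h.1
    refine ⟨f + g, fun u v huv hu hv => ?_⟩
    have h1 := hf u v huv hu hv
    have h2 := hg u v huv (fun e => hu (e ▸ h.2.1)) (fun e => hv (e ▸ h.2.1))
      (fun e => hu (e ▸ h.2.2)) (fun e => hv (e ▸ h.2.2))
    calc (f + g) u + (f + g) v = (f u + f v) + (g u + g v) := by
          simp only [Pi.add_apply]; ring
      _ = rayCochain a u v + rayCochain c u v + (rayCochain b u v + rayCochain b u v) := by
          rw [h1, h2]; ring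
      _ = _ := by rw [zmod_two_add_self, add_zero]

theorem exists_int_primitive (h : ℤ → ZMod 2) : ∃ H : ℤ → ZMod 2, ∀ i, H i + H (i + 1) = h i := by
  refine ⟨fun i => (∑ k ∈ Finset.Ico 0 i, h k) + ∑ k ∈ Finset.Ico i 0, h k, fun i => ?_⟩
  simp only
  rcases le_or_gt 0 i with hi | hi
  · rw [Finset.Ico_eq_empty (a := i) (by omega), Finset.Ico_eq_empty (a := i + 1) (by omega)]
    have : Finset.Ico 0 (i + 1) = insert i (Finset.Ico 0 i) := by
      ext; simp only [Finset.mem_Ico, Finset.mem_insert]; omega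
    rw [this, Finset.sum_insert (by simp)]
    linear_combination zmod_two_add_self (∑ k ∈ Finset.Ico 0 i, h k)
  · rw [Finset.Ico_eq_empty (b := i) (by omega), Finset.Ico_eq_empty (b := i + 1) (by omega)]
    have : Finset.Ico i 0 = insert i (Finset.Ico (i + 1) 0) := by
      ext; simp only [Finset.mem_Ico, Finset.mem_insert]; omega
    rw [this, Finset.sum_insert (by simp)]
    linear_combination zmod_two_add_self (∑ k ∈ Finset.Ico (i + 1) 0, h k)

/-- A cochain whose sum around every unit square vanishes is a coboundary. -/
theorem exists_primitive {c : Node → Node → ZMod 2} (hsymm : ∀ u v, c u v = c v u)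
    (hc : ∀ i j : ℤ, c (i, j) (i + 1, j) + c (i + 1, j) (i + 1, j + 1) +
      c (i, j + 1) (i + 1, j + 1) + c (i, j) (i, j + 1) = 0) :
    ∃ g : Node → ZMod 2, ∀ u v, latticeGraph.Adj u v → g u + g v = c u v := by
  obtain ⟨X, hX⟩ := exists_int_primitive fun i => c (i, 0) (i + 1, 0)
  choose Y hY using fun i => exists_int_primitive fun j => c (i, j) (i, j + 1)
  -- sum along the row `0` first, then along a column
  set g : Node → ZMod 2 := fun u => X u.1 + Y u.1 0 + Y u.1 u.2 with hg
  have hvert : ∀ i j, g (i, j) + g (i, j + 1) = c (i, j) (i, j + 1) := by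
    intro i j
    rw [← hY i j, hg]
    linear_combination zmod_two_add_self (X i + Y i 0)
  have hstep : ∀ i j, g (i, j) + g (i + 1, j) + c (i, j) (i + 1, j) =
      g (i, j + 1) + g (i + 1, j + 1) + c (i, j + 1) (i + 1, j + 1) := by
    intro i j
    have h1 := hc i j
    have h2 := hvert i j
    have h3 := hvert (i + 1) j
    rw [← sub_eq_zero, CharTwo.sub_eq_add]
    linear_combination h1 + h2 + h3
  have hhor : ∀ i j, g (i, j) + g (i + 1, j) = c (i, j) (i + 1, j) := by
    intro i j
    suffices h : g (i, j) + g (i + 1, j) + c (i, j) (i + 1, j) = 0 by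
      rwa [← CharTwo.sub_eq_add _ (c _ _), sub_eq_zero] at h
    induction j using Int.induction_on with
    | zero =>
      rw [← hX i, hg]
      linear_combination zmod_two_add_self (X i + X (i + 1) + Y i 0 + Y (i + 1) 0)
    | succ j ih => rw [← hstep i j, ih]
    | pred j ih =>
      have := hstep i (-j - 1)
      rw [sub_add_cancel] at this
      rw [this, ih]
  refine ⟨g, ?_⟩
  rintro ⟨a, b⟩ ⟨a', b'⟩ huv
  rw [latticeGraph_adj_iff] at huv
  simp only at huv
  rcases huv with ⟨rfl, rfl | rfl⟩ | ⟨rfl, rfl | rfl⟩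
  · exact hhor a b
  · rw [add_comm, hsymm]
    exact hhor a' b
  · exact hvert a b
  · rw [add_comm, hsymm]
    exact hvert a b'

/-- If a set is connected and its complement is `*`connected, then the nodes of the complement that
are adjacent to the set are `*`connected among themselves. Otherwise the edges that lead to one part
of these nodes would form a closed cochain, the coboundary of a function which is constant on the set
and on its complement. -/
theorem linked_outer_boundary {A : Set Node}
    (hA : ∀ x ∈ A, ∀ y ∈ A, Linked latticeGraph A x y)
    (hAc : ∀ x ∉ A, ∀ y ∉ A, Linked starGraph Aᶜ x y) {x y z z' : Node}
    (hx : x ∉ A) (hz : z ∈ A) (hxz : latticeGraph.Adj x z)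
    (hy : y ∉ A) (hz' : z' ∈ A) (hyz : latticeGraph.Adj y z') :
    Linked starGraph {w | w ∉ A ∧ ∃ z ∈ A, latticeGraph.Adj w z} x y := by
  classical
  set S : Set Node := {w | w ∉ A ∧ ∃ z ∈ A, latticeGraph.Adj w z}
  set T : Node → Prop := fun w => Linked starGraph S x w
  have hTadj : ∀ u v z z', starGraph.Adj u v → u ∉ A → z ∈ A → latticeGraph.Adj u z → v ∉ A →
      z' ∈ A → latticeGraph.Adj v z' → (T u ↔ T v) := by
    intro u v z z' huv hu hz huz hv hz' hvz
    have := Linked.step huv (A := S) ⟨hu, z, hz, huz⟩ ⟨hv, z', hz', hvz⟩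
    exact ⟨fun h => h.trans this, fun h => h.trans this.symm⟩
  set c : Node → Node → ZMod 2 := fun u v =>
    if (u ∈ A ∧ v ∉ A ∧ T v) ∨ (v ∈ A ∧ u ∉ A ∧ T u) then 1 else 0 with hc
  have hsymm : ∀ u v, c u v = c v u := by
    intro u v
    simp only [hc]
    congr 1
    rw [or_comm]
  obtain ⟨g, hg⟩ := exists_primitive hsymm (by
    intro i j
    have adj1 : latticeGraph.Adj (i, j) (i + 1, j) := by rw [latticeGraph_adj_iff]; simp
    have adj2 : latticeGraph.Adj (i + 1, j) (i + 1, j + 1) := by rw [latticeGraph_adj_iff]; simp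
    have adj3 : latticeGraph.Adj (i, j + 1) (i + 1, j + 1) := by rw [latticeGraph_adj_iff]; simp
    have adj4 : latticeGraph.Adj (i, j) (i, j + 1) := by rw [latticeGraph_adj_iff]; simp
    have adj5 : starGraph.Adj (i, j) (i + 1, j + 1) := by rw [starGraph_adj_iff]; simp
    have adj6 : starGraph.Adj (i + 1, j) (i, j + 1) := by rw [starGraph_adj_iff]; simp
    have s1 := starGraph_adj_of_latticeGraph_adj adj1
    have s2 := starGraph_adj_of_latticeGraph_adj adj2
    have s3 := starGraph_adj_of_latticeGraph_adj adj3
    have s4 := starGraph_adj_of_latticeGraph_adj adj4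
    generalize (i, j) = p at *
    generalize (i + 1, j) = q at *
    generalize (i + 1, j + 1) = r at *
    generalize (i, j + 1) = t at *
    have f1 := hTadj p q t r s1
    have f2 := hTadj q r p t s2
    have f3 := hTadj t r p q s3
    have f4 := hTadj p t q r s4
    have f5 := fun z => hTadj p r z z adj5
    have f6 := fun z => hTadj q t z z adj6
    have g1 := adj1.symm
    have g2 := adj2.symm
    have g3 := adj3.symm
    have g4 := adj4.symm
    by_cases hp : p ∈ A <;> by_cases hq : q ∈ A <;> by_cases hr : r ∈ A <;> by_cases ht : t ∈ A <;>
      simp only [hc, hp, hq, hr, ht, not_true, not_false_iff, true_and, false_and, or_false,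
        false_or, if_false, add_zero, zero_add] <;>
      split_ifs <;> first | rfl | (exfalso; grind))
  have heq : ∀ u v, g u + g v = 0 → g u = g v := fun u v h => CharTwo.add_eq_zero.1 h
  have hgA : ∀ u ∈ A, ∀ v ∈ A, g u = g v := by
    intro u hu v hv
    refine (hA u hu v hv).apply_eq g fun u v huv hu hv => heq u v ?_
    rw [hg u v huv]
    simp [hc, hu, hv]
  have hgAc' : ∀ u v, latticeGraph.Adj u v → u ∉ A → v ∉ A → g u = g v := by
    intro u v huv hu hv
    refine heq u v ?_
    rw [hg u v huv]
    simp [hc, hu, hv]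
  have hgAc : ∀ u ∉ A, ∀ v ∉ A, g u = g v := by
    intro u hu v hv
    refine (hAc u hu v hv).apply_eq g fun u v huv hu hv => ?_
    -- a diagonal step goes around a corner
    by_cases hlat : latticeGraph.Adj u v
    · exact hgAc' u v hlat hu hv
    obtain ⟨w, huw, hwv⟩ : ∃ w, latticeGraph.Adj u w ∧ latticeGraph.Adj w v := by
      rw [starGraph_adj_iff, abs_le, abs_le] at huv
      rw [latticeGraph_adj_iff] at hlat
      refine ⟨(u.1, v.2), latticeGraph_adj_iff.2 (Or.inr ⟨rfl, ?_⟩),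
        latticeGraph_adj_iff.2 (Or.inl ⟨rfl, ?_⟩)⟩ <;> simp only <;> omega
    rw [Set.mem_compl_iff] at hu hv
    by_cases hw : w ∈ A
    · refine heq u v ?_
      have h1 := hg u w huw
      have h2 := hg w v hwv
      have h3 : c u w = c w v := by
        have := hTadj u v w w huv hu hw huw hv hw hwv.symm
        simp [hc, hu, hv, hw, this]
      linear_combination h1 + h2 + h3 - zmod_two_add_self (g w) + zmod_two_add_self (c w v)
    · exact (hgAc' u w huw hu hw).trans (hgAc' w v hwv hw hv)
  have h1 := hg x z hxz
  have h2 := hg y z' hyz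
  have h3 : c x z = 1 := if_pos (Or.inr ⟨hz, hx, Linked.refl x⟩)
  by_contra hxy
  have h4 : c y z' = 0 := if_neg (by
    rintro (h | h)
    · exact hy h.1
    · exact hxy h.2.2)
  rw [hgAc x hx y hy, hgA z hz z' hz', h2, h3, h4] at h1
  exact absurd h1 (by decide)

/-! ### Infinite clusters and the filled `1*`cluster -/

/-- A walk in `A` that starts in a set which cannot be left along edges of `A` stays in this set. -/
theorem Linked.restrict {G : SimpleGraph Node} {A B : Set Node} {x y : Node}
    (hB : ∀ u v, G.Adj u v → u ∈ A → v ∈ A → u ∈ B → v ∈ B) (hx : x ∈ B) (h : Linked G A x y) :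
    Linked G B x y ∧ y ∈ B := by
  induction h with
  | refl => exact ⟨Linked.refl _, hx⟩
  | @tail b c _ h ih =>
    have hc := hB _ _ h.1 h.2.1 h.2.2 ih.2
    exact ⟨ih.1.trans (Linked.step h.1 ih.2 hc), hc⟩

theorem isCluster_linked {G : SimpleGraph Node} {s : Fin 2} {σ : Config} {x : Node}
    (hx : σ x = s) : IsCluster G s σ {y | Linked G {x | σ x = s} x y} where
  nonempty := ⟨x, Linked.refl _⟩
  spin _ hy := hy.mem_of_mem hx
  connected y hy z hz := by
    have hrestrict : ∀ w, Linked G {x | σ x = s} x w →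
        Linked G {y | Linked G {x | σ x = s} x y} x w := fun w hw =>
      (hw.restrict (fun u v huv hu hv h => h.trans (Linked.step huv hu hv)) (Linked.refl _)).1
    exact connectedIn_iff.2 ⟨hy, (hrestrict y hy).symm.trans (hrestrict z hz)⟩
  maximal z hz y hy h := hz (Linked.trans hy (connectedIn_iff.1 h).2.symm)

theorem IsCluster.eq_linked {G : SimpleGraph Node} {s : Fin 2} {σ : Config} {S : Set Node}
    {x : Node} (h : IsCluster G s σ S) (hx : x ∈ S) :
    S = {y | Linked G {x | σ x = s} x y} := by
  ext y
  constructor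
  · intro hy
    exact (connectedIn_iff.1 (h.connected x hx y hy)).2.mono h.spin
  · intro hy
    by_contra hyS
    exact h.maximal y hyS x hx
      (connectedIn_iff.2 ⟨Linked.mem_of_mem hy (h.spin x hx), Linked.symm hy⟩)

theorem escapes_of_mem_cluster {G : SimpleGraph Node} {s : Fin 2} {σ : Config} {S : Set Node}
    {x : Node} (h : IsCluster G s σ S) (hS : S.Infinite) (hx : x ∈ S) :
    Escapes G {x | σ x = s} x := by
  rw [escapes_iff_infinite (h.spin x hx), ← h.eq_linked hx]
  exact hS

theorem cluster_of_escapes {G : SimpleGraph Node} {s : Fin 2} {σ : Config} {x : Node}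
    (h : Escapes G {x | σ x = s} x) :
    IsCluster G s σ {y | Linked G {x | σ x = s} x y} ∧
      {y | Linked G {x | σ x = s} x y}.Infinite :=
  ⟨isCluster_linked h.1, (escapes_iff_infinite h.1).1 h⟩

theorem mem_infiniteOneStarCluster {σ : Config} {x : Node} :
    x ∈ infiniteOneStarCluster σ ↔ Escapes starGraph {x | σ x = 1} x := by
  constructor
  · rintro ⟨S, hS, hx⟩
    exact escapes_of_mem_cluster hS.1 hS.2 hx
  · intro h
    exact ⟨_, cluster_of_escapes h, Linked.refl x⟩

/-- A reformulation, in terms of walks, of the existence of a single infinite `0`cluster and a single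
infinite `1*`cluster. -/
structure Coexists (σ : Config) : Prop where
  exists_zero : ∃ x, Escapes latticeGraph {x | σ x = 0} x
  linked_zero : ∀ x y, Escapes latticeGraph {x | σ x = 0} x → Escapes latticeGraph {x | σ x = 0} y →
    Linked latticeGraph {x | σ x = 0} x y
  exists_one : ∃ x, Escapes starGraph {x | σ x = 1} x
  linked_one : ∀ x y, Escapes starGraph {x | σ x = 1} x → Escapes starGraph {x | σ x = 1} y →
    Linked starGraph {x | σ x = 1} x y

theorem exists_infiniteOneStarCluster_iff {σ : Config} :
    (∃ S, IsInfiniteOneStarCluster σ S) ↔ ∃ x, Escapes starGraph {x | σ x = 1} x := by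
  constructor
  · rintro ⟨S, hS⟩
    obtain ⟨x, hx⟩ := hS.1.nonempty
    exact ⟨x, escapes_of_mem_cluster hS.1 hS.2 hx⟩
  · rintro ⟨x, hx⟩
    exact ⟨_, cluster_of_escapes hx⟩

theorem coexists_of_unique {σ : Config} (h0 : ∃! S, IsInfiniteZeroCluster σ S)
    (h1 : ∀ S T, IsInfiniteOneStarCluster σ S → IsInfiniteOneStarCluster σ T → S = T)
    (h2 : ∃ x, Escapes starGraph {x | σ x = 1} x) : Coexists σ where
  exists_zero := by
    obtain ⟨S, hS, -⟩ := h0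
    obtain ⟨x, hx⟩ := hS.1.nonempty
    exact ⟨x, escapes_of_mem_cluster hS.1 hS.2 hx⟩
  linked_zero x y hx hy := by
    have h := h0.unique (cluster_of_escapes hx) (cluster_of_escapes hy)
    have : y ∈ {z | Linked latticeGraph {x | σ x = 0} x z} := by
      rw [h]
      exact Linked.refl y
    exact this
  exists_one := h2
  linked_one x y hx hy := by
    have h := h1 _ _ (cluster_of_escapes hx) (cluster_of_escapes hy)
    have : y ∈ {z | Linked starGraph {x | σ x = 1} x z} := by
      rw [h]
      exact Linked.refl y
    exact this

/-- The filled infinite `1*`cluster. -/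
def filledCluster (σ : Config) : Set Node := fillHoles (infiniteOneStarCluster σ)

theorem infiniteOneStarCluster_subset (σ : Config) :
    infiniteOneStarCluster σ ⊆ filledCluster σ := Set.subset_union_left

theorem mem_filledCluster_iff {σ : Config} {x : Node} (hx : x ∉ infiniteOneStarCluster σ) :
    x ∈ filledCluster σ ↔ {y | Linked latticeGraph (infiniteOneStarCluster σ)ᶜ x y}.Finite := by
  have h : ∀ y, ConnectedIn latticeGraph (infiniteOneStarCluster σ)ᶜ x y ↔
      Linked latticeGraph (infiniteOneStarCluster σ)ᶜ x y := fun y =>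
    connectedIn_iff.trans (and_iff_right hx)
  rw [filledCluster, fillHoles, Set.mem_union, Set.mem_ofPred_eq, or_iff_right hx, and_iff_right hx]
  simp only [h]

theorem mem_filledCluster_of_linked {σ : Config} {x y : Node} (hx : x ∈ filledCluster σ)
    (hxC : x ∉ infiniteOneStarCluster σ)
    (hxy : Linked latticeGraph (infiniteOneStarCluster σ)ᶜ x y) : y ∈ filledCluster σ := by
  have hyC : y ∉ infiniteOneStarCluster σ := hxy.mem_of_mem hxC
  rw [mem_filledCluster_iff hxC] at hx
  rw [mem_filledCluster_iff hyC]
  exact hx.subset fun z hz => hxy.trans hz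

/-- The infinite `0`cluster does not meet the filled `1*`cluster. -/
theorem not_mem_filledCluster_of_escapes {σ : Config} {x : Node}
    (hx : Escapes latticeGraph {x | σ x = 0} x) : x ∉ filledCluster σ := by
  have hsub : {x | σ x = 0} ⊆ (infiniteOneStarCluster σ)ᶜ := by
    intro y hy hyC
    have h1 : σ y = 1 := (mem_infiniteOneStarCluster.1 hyC).1
    rw [Set.mem_ofPred_eq, h1] at hy
    exact absurd hy (by decide)
  rw [mem_filledCluster_iff (hsub hx.1)]
  exact ((escapes_iff_infinite hx.1).1 hx).mono fun y hy => hy.mono hsub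

theorem mem_infiniteOneStarCluster_of_boundary {σ : Config} {x y : Node}
    (hx : x ∈ filledCluster σ) (hy : y ∉ filledCluster σ) (hxy : latticeGraph.Adj x y) :
    x ∈ infiniteOneStarCluster σ := by
  by_contra hxC
  exact hy (mem_filledCluster_of_linked hx hxC
    (Linked.step hxy hxC fun h => hy (infiniteOneStarCluster_subset σ h)))

/-- A node next to the filled `1*`cluster belongs to an infinite `0`cluster: a finite `0`cluster has a
`*`connected outer boundary of spin `1`, so if this boundary meets the infinite `1*`cluster then
it is contained in it, and the `0`cluster lies in a hole. -/
theorem escapes_of_boundary {σ : Config} {x y : Node}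
    (hx : x ∈ filledCluster σ) (hy : y ∉ filledCluster σ) (hxy : latticeGraph.Adj x y) :
    Escapes latticeGraph {x | σ x = 0} y := by
  have hxC := mem_infiniteOneStarCluster_of_boundary hx hy hxy
  have hxE := mem_infiniteOneStarCluster.1 hxC
  have hyC : y ∉ infiniteOneStarCluster σ := fun h => hy (infiniteOneStarCluster_subset σ h)
  have spin_cases : ∀ i : Fin 2, i ≠ 1 → i = 0 := by decide
  have hy0 : σ y = 0 := spin_cases _ fun h1 => hyC (mem_infiniteOneStarCluster.2
    (hxE.of_linked (Linked.step (starGraph_adj_of_latticeGraph_adj hxy) hxE.1 h1)))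
  by_contra hfin
  rw [escapes_iff_infinite hy0, Set.not_infinite] at hfin
  set Z : Set Node := {u | Linked latticeGraph {x | σ x = 0} y u}
  have hZ0 : ∀ u ∈ Z, σ u = 0 := fun u hu => hu.mem_of_mem hy0
  have hZone : {x | σ x = 1} ⊆ Zᶜ := by
    intro u hu huZ
    rw [Set.mem_ofPred_eq, hZ0 u huZ] at hu
    exact absurd hu (by decide)
  -- `V` is the exterior of the finite `0`cluster `Z`
  set V : Set Node := {u | Linked starGraph Zᶜ x u}
  have hVZ : ∀ u ∈ V, u ∉ Z := fun u hu => hu.mem_of_mem (hZone hxE.1)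
  obtain ⟨r, hr⟩ := exists_subset_box hfin
  have hfar : ∀ u ∉ box 0 r, u ∈ V := by
    intro u hu
    obtain ⟨v, hv, hxv⟩ := hxE.2 r
    exact (hxv.mono hZone).trans
      ((linked_compl_box hv hu).toStar.mono (Set.compl_subset_compl.2 hr))
  have hVstar : ∀ a ∉ Vᶜ, ∀ b ∉ Vᶜ, Linked starGraph Vᶜᶜ a b := by
    have key : ∀ a ∈ V, Linked starGraph V x a := fun a ha =>
      (ha.restrict (fun u v huv hu hv h => h.trans (Linked.step huv hu hv)) (Linked.refl _)).1
    intro a ha b hb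
    rw [Set.notMem_compl_iff] at ha hb
    rw [compl_compl]
    exact (key a ha).symm.trans (key b hb)
  -- a walk from a node outside `V` meets `Z` before it meets `V`
  have hstepV : ∀ u v, latticeGraph.Adj u v → u ∉ Z → v ∉ Z → u ∉ V → v ∉ V :=
    fun u v huv hu hv huV hvV => huV (Linked.trans hvV
      (Linked.step (starGraph_adj_of_latticeGraph_adj huv).symm hv hu))
  have hVconn : ∀ a ∈ Vᶜ, ∀ b ∈ Vᶜ, Linked latticeGraph Vᶜ a b := by
    have hZV : Z ⊆ Vᶜ := fun u hu huV => hVZ u huV hu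
    have hZlink : ∀ a ∈ Z, Linked latticeGraph Vᶜ y a := fun a ha =>
      ((ha.restrict (fun u v huv hu hv h => h.trans (Linked.step huv hu hv)) (Linked.refl _)).1).mono
        hZV
    suffices key : ∀ a ∈ Vᶜ, Linked latticeGraph Vᶜ y a from
      fun a ha b hb => (key a ha).symm.trans (key b hb)
    intro a ha
    by_cases haZ : a ∈ Z
    · exact hZlink a haZ
    obtain ⟨u, v, hau, huv, -, -, hu, hv⟩ := (linked_univ a y).exists_exit (B := Zᶜ) haZ
      (fun h => h (Linked.refl y))
    rw [Set.univ_inter] at hau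
    have := hau.restrict (B := Vᶜ) (fun u v huv hu hv h => hstepV u v huv hu hv h) ha
    rw [Set.mem_compl_iff, not_not] at hv
    exact (hZlink v hv).trans ((Linked.step huv this.2 (hZV hv)).symm.trans this.1.symm)
  have hyV : y ∈ Vᶜ := fun h => hVZ y h (Linked.refl y)
  -- the component of `y` outside the infinite `1*`cluster reaches `V`
  rw [mem_filledCluster_iff hyC] at hy
  obtain ⟨u, hyu, hu⟩ : ∃ u, Linked latticeGraph (infiniteOneStarCluster σ)ᶜ y u ∧ u ∈ V := by
    by_contra! hcon
    exact hy ((finite_box 0 r).subset fun u hu => by_contra fun hur => hcon u hu (hfar u hur))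
  obtain ⟨z, w, -, hzw, -, hw, hz, hwV⟩ := hyu.exists_exit (B := Vᶜ) hyV (fun h => h hu)
  have hlink := linked_outer_boundary (A := Vᶜ) hVconn hVstar (x := x) (y := w)
    (fun h => h (Linked.refl x)) hyV hxy hwV hz hzw.symm
  have hone : {w | w ∉ Vᶜ ∧ ∃ z ∈ Vᶜ, latticeGraph.Adj w z} ⊆ {x | σ x = 1} := by
    rintro w ⟨hw, z, hz, hwz⟩
    rw [Set.mem_compl_iff, not_not] at hw
    have hzZ : z ∈ Z := by_contra fun hzZ => hstepV z w hwz.symm hzZ (hVZ w hw) hz hw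
    by_contra hw1
    exact hVZ w hw (Linked.trans hzZ (Linked.step hwz.symm (hZ0 z hzZ) (spin_cases _ hw1)))
  exact hw (mem_infiniteOneStarCluster.2 (hxE.of_linked (hlink.mono hone)))

namespace Coexists

variable {σ : Config}

theorem linked_cluster (h : Coexists σ) {x y : Node} (hx : x ∈ infiniteOneStarCluster σ)
    (hy : y ∈ infiniteOneStarCluster σ) : Linked starGraph (infiniteOneStarCluster σ) x y := by
  refine ((h.linked_one x y (mem_infiniteOneStarCluster.1 hx)
    (mem_infiniteOneStarCluster.1 hy)).restrict (fun u v huv hu hv hu' => ?_) hx).1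
  rw [mem_infiniteOneStarCluster] at hu' ⊢
  exact hu'.of_linked (Linked.step huv hu hv)

theorem linked_filledCluster (h : Coexists σ) {x y : Node} (hx : x ∈ filledCluster σ)
    (hy : y ∈ filledCluster σ) : Linked starGraph (filledCluster σ) x y := by
  have hsub := infiniteOneStarCluster_subset σ
  obtain ⟨c, hc⟩ := h.exists_one
  rw [← mem_infiniteOneStarCluster] at hc
  suffices key : ∀ x ∈ filledCluster σ, Linked starGraph (filledCluster σ) x c from
    (key x hx).trans (key y hy).symm
  clear hx hy x y
  intro x hx
  by_cases hxC : x ∈ infiniteOneStarCluster σ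
  · exact (h.linked_cluster hxC hc).mono hsub
  obtain ⟨u, v, hxu, huv, -, -, -, hv⟩ := (linked_univ x c).exists_exit
    (B := (infiniteOneStarCluster σ)ᶜ) hxC (fun h => h hc)
  rw [Set.univ_inter] at hxu
  have hu := (hxu.restrict (B := {y | Linked latticeGraph (infiniteOneStarCluster σ)ᶜ x y})
    (fun u v huv hu hv h => h.trans (Linked.step huv hu hv)) (Linked.refl _)).1.mono
    (fun y hy => mem_filledCluster_of_linked hx hxC hy)
  rw [Set.mem_compl_iff, not_not] at hv
  exact hu.toStar.trans ((Linked.step (starGraph_adj_of_latticeGraph_adj huv) (hu.mem_of_mem hx)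
    (hsub hv)).trans ((h.linked_cluster hv hc).mono hsub))

theorem infinite_filledCluster (h : Coexists σ) : (filledCluster σ).Infinite := by
  obtain ⟨c, hc⟩ := h.exists_one
  refine ((escapes_iff_infinite hc.1).1 hc).mono fun y hy => ?_
  exact infiniteOneStarCluster_subset σ (mem_infiniteOneStarCluster.2 (hc.of_linked hy))

theorem exists_boundary (h : Coexists σ) :
    ∃ x y, latticeGraph.Adj x y ∧ x ∈ filledCluster σ ∧ y ∉ filledCluster σ := by
  obtain ⟨c, hc⟩ := h.exists_one
  obtain ⟨z, hz⟩ := h.exists_zero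
  obtain ⟨u, v, -, huv, -, -, hu, hv⟩ := (linked_univ c z).exists_exit (B := filledCluster σ)
    (infiniteOneStarCluster_subset σ (mem_infiniteOneStarCluster.2 hc))
    (not_mem_filledCluster_of_escapes hz)
  exact ⟨u, v, huv, hu, hv⟩

end Coexists

/-- Removing a box from an infinite `*`connected set cuts off only finitely many nodes, since every
part that is cut off contains a neighbour of the box. -/
theorem finite_not_escapes {W : Set Node} (hW : W.Infinite)
    (hlink : ∀ x ∈ W, ∀ y ∈ W, Linked starGraph W x y) (c : Node) (r : ℕ) :
    {x | x ∈ W \ box c r ∧ ¬ Escapes starGraph (W \ box c r) x}.Finite := by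
  set N : Set Node := {v | v ∈ box c (r + 1) ∧ v ∈ W \ box c r ∧
    ¬ Escapes starGraph (W \ box c r) v}
  have hNfin : N.Finite := (finite_box c (r + 1)).subset fun v hv => hv.1
  refine (hNfin.biUnion (t := fun v => {y | Linked starGraph (W \ box c r) v y}) ?_).subset ?_
  · rintro v ⟨-, hv, hv'⟩
    rwa [escapes_iff_infinite hv, Set.not_infinite] at hv'
  · rintro x ⟨hx, hx'⟩
    have hfin := hx'
    rw [escapes_iff_infinite hx, Set.not_infinite] at hfin
    obtain ⟨z, hzW, hz⟩ := hW.exists_notMem_finite hfin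
    obtain ⟨u, v, hxu, huv, huW, hvW, hu, hv⟩ := (hlink x hx.1 z hzW).exists_exit
      (B := {y | Linked starGraph (W \ box c r) x y}) (Linked.refl x) hz
    have hu' : u ∈ W \ box c r := Linked.mem_of_mem hu hx
    have hvB : v ∈ box c r := by
      by_contra hvB
      exact hv (Linked.trans hu (Linked.step huv hu' ⟨hvW, hvB⟩))
    refine Set.mem_biUnion (x := u) ⟨?_, hu', fun hE => hx' (hE.of_linked (Linked.symm hu))⟩
      (Linked.symm hu)
    rw [starGraph_adj_iff, abs_le, abs_le] at huv
    rw [mem_box] at hvB ⊢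
    push_cast
    omega

/-! ### The filled cluster as a function of its boundary -/

/-- The point of the edge from `u` to `v` at distance `3/4` from `u`, that is, on the boundary of the
square with centre `u`. -/
noncomputable def marker (u v : Node) : ℝ × ℝ :=
  ((u.1 : ℝ) + 3 / 4 * (v.1 - u.1), (u.2 : ℝ) + 3 / 4 * (v.2 - u.2))

/-- The closed set `F` meets the small ball around the marker of the directed edge from `u` to `v`. -/
def Hits (F : Closeds (ℝ × ℝ)) (u v : Node) : Prop :=
  ((F : Set (ℝ × ℝ)) ∩ Metric.ball (marker u v) (1 / 8)).Nonempty

theorem mem_square {x : Node} {p : ℝ × ℝ} :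
    p ∈ square x ↔ ((x.1 : ℝ) - 3 / 4 ≤ p.1 ∧ p.1 ≤ (x.1 : ℝ) + 3 / 4) ∧
      (x.2 : ℝ) - 3 / 4 ≤ p.2 ∧ p.2 ≤ (x.2 : ℝ) + 3 / 4 := Iff.rfl

theorem mem_ball_prod {m p : ℝ × ℝ} {ε : ℝ} :
    p ∈ Metric.ball m ε ↔ (m.1 - ε < p.1 ∧ p.1 < m.1 + ε) ∧ m.2 - ε < p.2 ∧ p.2 < m.2 + ε := by
  rw [Metric.mem_ball, Prod.dist_eq, max_lt_iff, Real.dist_eq, Real.dist_eq, abs_lt, abs_lt]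
  constructor <;> rintro ⟨⟨h1, h2⟩, h3, h4⟩ <;> refine ⟨⟨?_, ?_⟩, ?_, ?_⟩ <;> linarith

/-- Near the marker of an edge only the squares of the two ends of the edge matter. -/
theorem eq_or_eq_of_mem_square {u v z : Node} (h : latticeGraph.Adj u v) {p : ℝ × ℝ}
    (hp : p ∈ Metric.ball (marker u v) (1 / 8)) (hz : p ∈ square z) : z = u ∨ z = v := by
  rw [mem_ball_prod] at hp
  rw [mem_square] at hz
  simp only [marker] at hp
  rw [latticeGraph_adj_iff] at h
  rw [Prod.ext_iff, Prod.ext_iff]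
  obtain ⟨⟨h1, h2⟩, h3, h4⟩ := hp
  obtain ⟨⟨h5, h6⟩, h7, h8⟩ := hz
  obtain ⟨u1, u2⟩ := u
  obtain ⟨v1, v2⟩ := v
  simp only at *
  rcases h with ⟨rfl, rfl | rfl⟩ | ⟨rfl, rfl | rfl⟩ <;> push_cast at h1 h2 h3 h4
  · have e1 : (u1 : ℝ) - 1 < z.1 := by linarith
    have e2 : (z.1 : ℝ) < u1 + 2 := by linarith
    have e3 : (u2 : ℝ) - 1 < z.2 := by linarith
    have e4 : (z.2 : ℝ) < u2 + 1 := by linarith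
    norm_cast at e1 e2 e3 e4
    omega
  · have e1 : (v1 : ℝ) - 1 < z.1 := by linarith
    have e2 : (z.1 : ℝ) < v1 + 2 := by linarith
    have e3 : (u2 : ℝ) - 1 < z.2 := by linarith
    have e4 : (z.2 : ℝ) < u2 + 1 := by linarith
    norm_cast at e1 e2 e3 e4
    omega
  · have e1 : (u1 : ℝ) - 1 < z.1 := by linarith
    have e2 : (z.1 : ℝ) < u1 + 1 := by linarith
    have e3 : (u2 : ℝ) - 1 < z.2 := by linarith
    have e4 : (z.2 : ℝ) < u2 + 2 := by linarith
    norm_cast at e1 e2 e3 e4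
    omega
  · have e1 : (u1 : ℝ) - 1 < z.1 := by linarith
    have e2 : (z.1 : ℝ) < u1 + 1 := by linarith
    have e3 : (v2 : ℝ) - 1 < z.2 := by linarith
    have e4 : (z.2 : ℝ) < v2 + 2 := by linarith
    norm_cast at e1 e2 e3 e4
    omega

theorem ball_marker_subset {u v : Node} (h : latticeGraph.Adj u v) :
    Metric.ball (marker u v) (1 / 8) ⊆ square v := by
  intro p hp
  rw [mem_ball_prod] at hp
  rw [mem_square]
  simp only [marker] at hp
  rw [latticeGraph_adj_iff] at h
  obtain ⟨⟨h1, h2⟩, h3, h4⟩ := hp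
  obtain ⟨u1, u2⟩ := u
  obtain ⟨v1, v2⟩ := v
  simp only at *
  rcases h with ⟨rfl, rfl | rfl⟩ | ⟨rfl, rfl | rfl⟩ <;> push_cast at * <;>
    refine ⟨⟨?_, ?_⟩, ?_, ?_⟩ <;> linarith

theorem marker_mem_square {u v : Node} (h : latticeGraph.Adj u v) : marker u v ∈ square u := by
  rw [mem_square]
  simp only [marker]
  rw [latticeGraph_adj_iff] at h
  obtain ⟨u1, u2⟩ := u
  obtain ⟨v1, v2⟩ := v
  simp only at *
  rcases h with ⟨rfl, rfl | rfl⟩ | ⟨rfl, rfl | rfl⟩ <;> push_cast <;>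
    refine ⟨⟨?_, ?_⟩, ?_, ?_⟩ <;> linarith

theorem exists_near_marker {u v : Node} (h : latticeGraph.Adj u v) {ε : ℝ} (hε : 0 < ε) :
    ∃ p ∈ Metric.ball (marker u v) ε, p ∉ square u := by
  refine ⟨marker u v + (ε / 2 * (v.1 - u.1), ε / 2 * (v.2 - u.2)), ?_, ?_⟩
  · rw [mem_ball_prod]
    simp only [Prod.fst_add, Prod.snd_add]
    rw [latticeGraph_adj_iff] at h
    obtain ⟨u1, u2⟩ := u
    obtain ⟨v1, v2⟩ := v
    simp only at *
    rcases h with ⟨rfl, rfl | rfl⟩ | ⟨rfl, rfl | rfl⟩ <;> push_cast <;>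
      refine ⟨⟨?_, ?_⟩, ?_, ?_⟩ <;> linarith
  · rw [mem_square]
    simp only [Prod.fst_add, Prod.snd_add, marker]
    rw [latticeGraph_adj_iff] at h
    obtain ⟨u1, u2⟩ := u
    obtain ⟨v1, v2⟩ := v
    simp only at *
    rcases h with ⟨rfl, rfl | rfl⟩ | ⟨rfl, rfl | rfl⟩ <;> push_cast <;>
      rintro ⟨⟨h1, h2⟩, h3, h4⟩ <;> linarith

theorem hits_frontier_iff (W : Set Node) {u v : Node} (h : latticeGraph.Adj u v) :
    Hits ⟨frontier (⋃ x ∈ W, square x), isClosed_frontier⟩ u v ↔ u ∈ W ∧ v ∉ W := by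
  set U : Set (ℝ × ℝ) := ⋃ x ∈ W, square x with hU
  change (frontier U ∩ Metric.ball (marker u v) (1 / 8)).Nonempty ↔ _
  constructor
  · rintro ⟨p, hpU, hp⟩
    have hv : v ∉ W := by
      intro hv
      have hsub : Metric.ball (marker u v) (1 / 8) ⊆ U :=
        (ball_marker_subset h).trans (Set.subset_biUnion_of_mem (u := square) hv)
      exact hpU.2 (interior_maximal hsub Metric.isOpen_ball hp)
    refine ⟨?_, hv⟩
    by_contra hu
    obtain ⟨q, hq, hqU⟩ := mem_closure_iff.1 hpU.1 _ Metric.isOpen_ball hp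
    obtain ⟨z, hz, hqz⟩ := Set.mem_iUnion₂.1 hqU
    rcases eq_or_eq_of_mem_square h hq hqz with rfl | rfl
    · exact hu hz
    · exact hv hz
  · rintro ⟨hu, hv⟩
    refine ⟨marker u v, ⟨subset_closure (Set.mem_biUnion hu (marker_mem_square h)), ?_⟩,
      Metric.mem_ball_self (by norm_num)⟩
    intro hint
    obtain ⟨ε, hε, hsub⟩ := Metric.mem_nhds_iff.1 (mem_interior_iff_mem_nhds.1 hint)
    obtain ⟨p, hp, hpu⟩ := exists_near_marker h (lt_min hε (by norm_num : (0 : ℝ) < 1 / 8))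
    obtain ⟨z, hz, hpz⟩ := Set.mem_iUnion₂.1 (hsub (Metric.ball_subset_ball (min_le_left _ _) hp))
    rcases eq_or_eq_of_mem_square h (Metric.ball_subset_ball (min_le_right _ _) hp) hpz with
      rfl | rfl
    · exact hpu hpz
    · exact hv hz

/-- The set of nodes that is recovered from the boundary `F` of its union of squares: the nodes from
which one reaches, without crossing `F`, an edge that crosses `F` outwards. -/
def decode (F : Closeds (ℝ × ℝ)) : Set Node :=
  {x | ∃ y z, latticeGraph.Adj y z ∧ Hits F y z ∧
    Relation.ReflTransGen (fun u v => latticeGraph.Adj u v ∧ ¬ Hits F u v ∧ ¬ Hits F v u) x y}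

theorem decode_frontier {W : Set Node} {b : Node} (hb : b ∉ W) :
    decode ⟨frontier (⋃ x ∈ W, square x), isClosed_frontier⟩ = W := by
  ext x
  constructor
  · rintro ⟨y, z, hyz, hhit, hxy⟩
    have hy : y ∈ W := ((hits_frontier_iff W hyz).1 hhit).1
    clear hhit hyz
    induction hxy with
    | refl => exact hy
    | tail _ h ih =>
      refine ih (by_contra fun hb => h.2.2 ?_)
      rw [hits_frontier_iff W h.1.symm]
      exact ⟨hy, hb⟩
  · intro hx
    obtain ⟨u, v, hxu, huv, -, -, hu, hv⟩ := (linked_univ x b).exists_exit (B := W) hx hb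
    refine ⟨u, v, huv, (hits_frontier_iff W huv).2 ⟨hu, hv⟩, ?_⟩
    rw [Set.univ_inter] at hxu
    refine Relation.ReflTransGen.mono ?_ _ _ hxu
    rintro c d ⟨hcd, hc, hd⟩
    refine ⟨hcd, ?_, ?_⟩
    · rw [hits_frontier_iff W hcd]
      exact fun h => h.2 hd
    · rw [hits_frontier_iff W hcd.symm]
      exact fun h => h.2 hc

theorem hits_translate_of_hits {F : Closeds (ℝ × ℝ)} {x y : Node} (v : Node) (h : Hits F x y) :
    Hits (translate v F) (x + v) (y + v) := by
  obtain ⟨p, hpF, hp⟩ := h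
  refine ⟨p + ((v.1 : ℝ), (v.2 : ℝ)), ⟨p, hpF, rfl⟩, ?_⟩
  rw [mem_ball_prod] at hp ⊢
  simp only [marker, Prod.fst_add, Prod.snd_add, Int.cast_add] at hp ⊢
  refine ⟨⟨?_, ?_⟩, ?_, ?_⟩ <;> linarith

theorem translate_neg_translate (v : Node) (F : Closeds (ℝ × ℝ)) :
    translate (-v) (translate v F) = F := by
  apply Closeds.ext
  change (fun p : ℝ × ℝ => p + (((-v).1 : ℝ), ((-v).2 : ℝ))) ''
    ((fun p : ℝ × ℝ => p + ((v.1 : ℝ), (v.2 : ℝ))) '' (F : Set (ℝ × ℝ))) = F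
  rw [Set.image_image]
  convert Set.image_id _ using 2
  ext p <;> simp

theorem hits_translate {F : Closeds (ℝ × ℝ)} {x y : Node} (v : Node) :
    Hits (translate v F) (x + v) (y + v) ↔ Hits F x y := by
  refine ⟨fun h => ?_, hits_translate_of_hits v⟩
  have := hits_translate_of_hits (-v) h
  rwa [translate_neg_translate, add_neg_cancel_right, add_neg_cancel_right] at this

theorem latticeGraph_adj_add {x y : Node} (v : Node) :
    latticeGraph.Adj (x + v) (y + v) ↔ latticeGraph.Adj x y := by
  simp only [latticeGraph_adj_iff, Prod.fst_add, Prod.snd_add]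
  omega

theorem starGraph_adj_add {x y : Node} (v : Node) :
    starGraph.Adj (x + v) (y + v) ↔ starGraph.Adj x y := by
  simp only [starGraph_adj_iff, Prod.fst_add, Prod.snd_add, add_sub_add_right_eq_sub,
    add_left_inj]

theorem add_mem_decode_translate {F : Closeds (ℝ × ℝ)} {x : Node} (v : Node) (h : x ∈ decode F) :
    x + v ∈ decode (translate v F) := by
  obtain ⟨y, z, hyz, hhit, hxy⟩ := h
  refine ⟨y + v, z + v, (latticeGraph_adj_add v).2 hyz, (hits_translate v).2 hhit,
    Relation.ReflTransGen.lift (fun x => x + v) ?_ _ _ hxy⟩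
  rintro a b ⟨hab, h1, h2⟩
  exact ⟨(latticeGraph_adj_add v).2 hab, fun h => h1 ((hits_translate v).1 h),
    fun h => h2 ((hits_translate v).1 h)⟩

theorem mem_decode_translate {F : Closeds (ℝ × ℝ)} {x : Node} (v : Node) :
    x ∈ decode (translate v F) ↔ x - v ∈ decode F := by
  constructor
  · intro h
    have := add_mem_decode_translate (-v) h
    rwa [translate_neg_translate, ← sub_eq_add_neg] at this
  · intro h
    have := add_mem_decode_translate v h
    rwa [sub_add_cancel] at this

theorem Coexists.decode_infiniteBoundary {σ : Config} (h : Coexists σ) :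
    decode (infiniteBoundary σ) = filledCluster σ := by
  obtain ⟨x, hx⟩ := h.exists_zero
  exact decode_frontier (not_mem_filledCluster_of_escapes hx)

/-! ### Measurability -/

theorem measurableSet_reflTransGen {Ω X : Type*} [MeasurableSpace Ω] [Countable X]
    {R : Ω → X → X → Prop} (hR : ∀ x y, MeasurableSet {ω | R ω x y}) (x y : X) :
    MeasurableSet {ω | Relation.ReflTransGen (R ω) x y} := by
  -- `S n y` is the event that `y` can be reached from `x` in exactly `n` steps
  let S : ℕ → X → Set Ω := fun n => Nat.rec (fun y => {_ω | x = y})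
    (fun _ T y => ⋃ z, T z ∩ {ω | R ω z y}) n
  have hS : ∀ n y, MeasurableSet (S n y) := by
    intro n
    induction n with
    | zero => exact fun y => MeasurableSet.const _
    | succ n ih => exact fun y => MeasurableSet.iUnion fun z => (ih z).inter (hR z y)
  have heq : {ω | Relation.ReflTransGen (R ω) x y} = ⋃ n, S n y := by
    ext ω
    rw [Set.mem_iUnion]
    constructor
    · intro h
      change Relation.ReflTransGen (R ω) x y at h
      induction h with
      | refl => exact ⟨0, rfl⟩
      | @tail b c _ h ih =>
        obtain ⟨n, hn⟩ := ih
        exact ⟨n + 1, Set.mem_iUnion.2 ⟨b, hn, h⟩⟩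
    · rintro ⟨n, hn⟩
      change Relation.ReflTransGen (R ω) x y
      induction n generalizing y with
      | zero =>
        obtain rfl : x = y := hn
        exact Relation.ReflTransGen.refl
      | succ n ih =>
        obtain ⟨z, hz, hzy⟩ := Set.mem_iUnion.1 hn
        exact (ih z hz).tail hzy
  rw [heq]
  exact MeasurableSet.iUnion fun n => hS n y

section RandomSet

variable {Ω : Type*} [MeasurableSpace Ω] {A : Ω → Set Node}

theorem measurableSet_linked (G : SimpleGraph Node) (hA : ∀ x, MeasurableSet {ω | x ∈ A ω})
    (x y : Node) : MeasurableSet {ω | Linked G (A ω) x y} :=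
  measurableSet_reflTransGen (fun x y => (MeasurableSet.const _).inter ((hA x).inter (hA y))) x y

theorem measurableSet_escapes (G : SimpleGraph Node) (hA : ∀ x, MeasurableSet {ω | x ∈ A ω})
    (x : Node) : MeasurableSet {ω | Escapes G (A ω) x} := by
  have heq : {ω | Escapes G (A ω) x} = {ω | x ∈ A ω} ∩
      ⋂ r : ℕ, ⋃ u, {_ω | u ∉ box 0 r} ∩ {ω | Linked G (A ω) x u} := by
    ext ω
    simp [Escapes]
  rw [heq]
  exact (hA x).inter (MeasurableSet.iInter fun r => MeasurableSet.iUnion fun u =>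
    (MeasurableSet.const _).inter (measurableSet_linked G hA x u))

end RandomSet

theorem measurableSet_spin (s : Fin 2) (x : Node) :
    MeasurableSet {σ : Config | x ∈ {x | σ x = s}} :=
  measurableSet_eq_fun (measurable_pi_apply x) measurable_const

theorem measurableSet_hits (u v : Node) : MeasurableSet[closedSetsSigma] {F | Hits F u v} :=
  MeasurableSpace.measurableSet_generateFrom ⟨_, Metric.isOpen_ball, rfl⟩

theorem measurable_decode : @Measurable _ _ closedSetsSigma _ decode := by
  let _ := closedSetsSigma
  rw [measurable_set_iff]
  intro x
  apply measurableSet_setOfPred.1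
  have heq : {F | x ∈ decode F} = ⋃ y, ⋃ z, {_F | latticeGraph.Adj y z} ∩ ({F | Hits F y z} ∩
      {F | Relation.ReflTransGen
        (fun u v => latticeGraph.Adj u v ∧ ¬ Hits F u v ∧ ¬ Hits F v u) x y}) := by
    ext F
    simp [decode]
  rw [heq]
  exact MeasurableSet.iUnion fun y => MeasurableSet.iUnion fun z => (MeasurableSet.const _).inter
    ((measurableSet_hits y z).inter (measurableSet_reflTransGen (fun u v =>
      (MeasurableSet.const _).inter
        ((measurableSet_hits u v).compl.inter (measurableSet_hits v u).compl)) x y))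

/-- The law of the filled cluster is invariant under translations. -/
theorem measure_filledCluster_translate {μ : Measure Config}
    (hinv : BoundaryLawTranslationInvariant μ) (hco : ∀ᵐ σ ∂μ[|coexistence], Coexists σ) (v : Node)
    {𝒮 : Set (Set Node)} (h𝒮 : MeasurableSet 𝒮) :
    μ[|coexistence] {σ | {x | x + v ∈ filledCluster σ} ∈ 𝒮} =
      μ[|coexistence] {σ | filledCluster σ ∈ 𝒮} := by
  have h := hinv (-v) (decode ⁻¹' 𝒮) (measurable_decode h𝒮)
  have h1 : μ[|coexistence] {σ | {x | x + v ∈ filledCluster σ} ∈ 𝒮} =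
      μ[|coexistence] {σ | translate (-v) (infiniteBoundary σ) ∈ decode ⁻¹' 𝒮} := by
    apply measure_congr
    filter_upwards [hco] with σ hσ
    apply propext
    change _ ∈ 𝒮 ↔ decode _ ∈ 𝒮
    have : decode (translate (-v) (infiniteBoundary σ)) = {x | x + v ∈ filledCluster σ} := by
      ext x
      rw [mem_decode_translate, hσ.decode_infiniteBoundary, sub_neg_eq_add]
      rfl
    rw [this]
  have h2 : μ[|coexistence] {σ | filledCluster σ ∈ 𝒮} =
      μ[|coexistence] {σ | infiniteBoundary σ ∈ decode ⁻¹' 𝒮} := by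
    apply measure_congr
    filter_upwards [hco] with σ hσ
    apply propext
    change _ ∈ 𝒮 ↔ decode _ ∈ 𝒮
    rw [hσ.decode_infiniteBoundary]
  rw [h1, h2, h]

/-- The sets of nodes in which the removal of the box of radius `m` around the origin cuts off from
infinity a node outside the box of radius `R`. -/
def cutOff (m R : ℕ) : Set (Set Node) :=
  {W | ∃ x, x ∉ box 0 R ∧ x ∈ W \ box 0 m ∧ ¬ Escapes starGraph (W \ box 0 m) x}

theorem measurableSet_cutOff (m R : ℕ) : MeasurableSet (cutOff m R) := by
  have hmem : ∀ x : Node, MeasurableSet {W : Set Node | x ∈ W \ box 0 m} := fun x =>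
    (measurableSet_setOfPred.2 (measurable_set_mem x)).inter (MeasurableSet.const _)
  have heq : cutOff m R = ⋃ x, {_W | x ∉ box 0 R} ∩ ({W : Set Node | x ∈ W \ box 0 m} ∩
      {W | Escapes starGraph (W \ box 0 m) x}ᶜ) := by
    ext W
    simp [cutOff]
  rw [heq]
  exact MeasurableSet.iUnion fun x => (MeasurableSet.const _).inter
    ((hmem x).inter (measurableSet_escapes starGraph hmem x).compl)

theorem exists_notMem_cutOff {W : Set Node} (hW : W.Infinite)
    (hlink : ∀ x ∈ W, ∀ y ∈ W, Linked starGraph W x y) (m : ℕ) : ∃ R, W ∉ cutOff m R := by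
  obtain ⟨R, hR⟩ := exists_subset_box (finite_not_escapes hW hlink 0 m)
  refine ⟨R, ?_⟩
  rintro ⟨x, hxR, hx, hx'⟩
  exact hxR (hR ⟨hx, hx'⟩)

theorem escapes_of_translate {W : Set Node} {c x : Node} {m : ℕ}
    (h : Escapes starGraph ({x | x + c ∈ W} \ box 0 m) x) :
    Escapes starGraph (W \ box c m) (x + c) := by
  have hmem : ∀ y, y ∈ {x | x + c ∈ W} \ box 0 m → y + c ∈ W \ box c m := by
    rintro y ⟨hy, hy'⟩
    refine ⟨hy, fun h => hy' ?_⟩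
    rw [mem_box] at h ⊢
    simp only [Prod.fst_add, Prod.snd_add, Prod.fst_zero, Prod.snd_zero] at h ⊢
    omega
  refine ⟨hmem x h.1, fun r => ?_⟩
  obtain ⟨k, hk⟩ := exists_mem_box c
  obtain ⟨u, hu, hxu⟩ := h.2 (r + k)
  refine ⟨u + c, fun h => hu ?_, Relation.ReflTransGen.lift (fun y => y + c) ?_ _ _ hxu⟩
  · rw [mem_box] at h hk ⊢
    simp only [Prod.fst_add, Prod.snd_add, Prod.fst_zero, Prod.snd_zero] at h hk ⊢
    push_cast
    omega
  · rintro a b ⟨hab, ha, hb⟩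
    exact ⟨(starGraph_adj_add c).2 hab, hmem a ha, hmem b hb⟩

/-! ### Infinite `0`paths and their parity -/

/-- One step of a walk in `A`, where the second component records modulo two the sum of the cochain
`ω` along the walk. -/
def ParityStep (ω : Node → Node → ZMod 2) (A : Set Node) (p q : Node × ZMod 2) : Prop :=
  latticeGraph.Adj p.1 q.1 ∧ p.1 ∈ A ∧ q.1 ∈ A ∧ q.2 = p.2 + ω p.1 q.1

/-- Walks in `A` along which the cochain `ω` sums to `i` lead from `x` out of every box. -/
def EscapesWithParity (ω : Node → Node → ZMod 2) (A : Set Node) (x : Node) (i : ZMod 2) : Prop :=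
  x ∈ A ∧ ∀ r : ℕ, ∃ u, u ∉ box 0 r ∧ Relation.ReflTransGen (ParityStep ω A) (x, 0) (u, i)

section Parity

variable {ω : Node → Node → ZMod 2} {A B : Set Node} {x y : Node} {i : ZMod 2}

theorem linked_of_parityStep {p q : Node × ZMod 2}
    (h : Relation.ReflTransGen (ParityStep ω A) p q) : Linked latticeGraph A p.1 q.1 :=
  Relation.ReflTransGen.lift Prod.fst (fun _ _ h => ⟨h.1, h.2.1, h.2.2.1⟩) _ _ h

theorem EscapesWithParity.escapes (h : EscapesWithParity ω A x i) : Escapes latticeGraph A x :=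
  ⟨h.1, fun r => let ⟨u, hu, hxu⟩ := h.2 r; ⟨u, hu, linked_of_parityStep hxu⟩⟩

theorem EscapesWithParity.mono (hAB : A ⊆ B) (h : EscapesWithParity ω A x i) :
    EscapesWithParity ω B x i :=
  ⟨hAB h.1, fun r => let ⟨u, hu, hxu⟩ := h.2 r
    ⟨u, hu, Relation.ReflTransGen.mono
      (fun _ _ h => ⟨h.1, hAB h.2.1, hAB h.2.2.1, h.2.2.2⟩) _ _ hxu⟩⟩

theorem Escapes.exists_parity (ω : Node → Node → ZMod 2) (h : Escapes latticeGraph A x) :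
    EscapesWithParity ω A x 0 ∨ EscapesWithParity ω A x 1 := by
  have hlift : ∀ u, Linked latticeGraph A x u →
      ∃ i, Relation.ReflTransGen (ParityStep ω A) (x, 0) (u, i) := by
    intro u hu
    induction hu with
    | refl => exact ⟨0, Relation.ReflTransGen.refl⟩
    | @tail b c _ h ih =>
      obtain ⟨i, hi⟩ := ih
      exact ⟨i + ω b c, hi.tail ⟨h.1, h.2.1, h.2.2, rfl⟩⟩
  by_contra! hcon
  obtain ⟨h0, h1⟩ := hcon
  simp only [EscapesWithParity, not_and, not_forall, not_exists] at h0 h1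
  obtain ⟨r, hr⟩ := h0 h.1
  obtain ⟨s, hs⟩ := h1 h.1
  obtain ⟨u, hu, hxu⟩ := h.2 (max r s)
  obtain ⟨i, hi⟩ := hlift u hxu
  have hi01 : i = 0 ∨ i = 1 := by clear hi; revert i; decide
  rcases hi01 with rfl | rfl
  · exact hr u (fun h => hu (box_mono 0 (le_max_left _ _) h)) hi
  · exact hs u (fun h => hu (box_mono 0 (le_max_right _ _) h)) hi

/-- If `ω` is the coboundary of `f` on `A`, then its sum along a walk is the difference of the values
of `f` at the ends. -/
theorem potential_of_parityStep {f : Node → ZMod 2}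
    (hf : ∀ u v, latticeGraph.Adj u v → u ∈ A → v ∈ A → f u + f v = ω u v) {p q : Node × ZMod 2}
    (h : Relation.ReflTransGen (ParityStep ω A) p q) : f p.1 + p.2 = f q.1 + q.2 := by
  induction h with
  | refl => rfl
  | @tail b c _ h ih =>
    rw [ih, h.2.2.2]
    linear_combination zmod_two_add_self (f b.1 - ω b.1 c.1) - hf _ _ h.1 h.2.1 h.2.2.1

theorem measurableSet_escapesWithParity (ω : Node → Node → ZMod 2) (x : Node) (i : ZMod 2) :
    MeasurableSet {σ : Config | EscapesWithParity ω {x | σ x = 0} x i} := by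
  have heq : {σ : Config | EscapesWithParity ω {x | σ x = 0} x i} =
      {σ : Config | x ∈ {x | σ x = 0}} ∩ ⋂ r : ℕ, ⋃ u, {_σ : Config | u ∉ box 0 r} ∩
        {σ | Relation.ReflTransGen (ParityStep ω {x | σ x = 0}) (x, 0) (u, i)} := by
    ext σ
    simp [EscapesWithParity]
  rw [heq]
  exact (measurableSet_spin 0 x).inter (MeasurableSet.iInter fun r => MeasurableSet.iUnion fun u =>
    (MeasurableSet.const _).inter (measurableSet_reflTransGen (X := Node × ZMod 2) (fun p q =>
      (MeasurableSet.const _).inter ((measurableSet_spin 0 p.1).inter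
        ((measurableSet_spin 0 q.1).inter (MeasurableSet.const _)))) _ _))

end Parity

theorem Linked.exists_box {G : SimpleGraph Node} {A : Set Node} {x y : Node}
    (h : Linked G A x y) : ∃ r, Linked G (A ∩ box 0 r) x y := by
  induction h with
  | refl => exact ⟨0, Linked.refl _⟩
  | @tail b c _ h ih =>
    obtain ⟨r, hr⟩ := ih
    obtain ⟨s, hs⟩ := exists_mem_box b
    obtain ⟨t, ht⟩ := exists_mem_box c
    refine ⟨r + s + t, (hr.mono (Set.inter_subset_inter_right _ (box_mono 0 (by omega)))).trans
      (Linked.step h.1 ⟨h.2.1, box_mono 0 (by omega) hs⟩ ⟨h.2.2, box_mono 0 (by omega) ht⟩)⟩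

/-- The edges that are crossed by exactly one of the rays from `a` and from `b`; if `a` and `b` lie in
the same row, these are the edges that cross the segment between `a` and `b`. -/
def segmentCochain (a b u v : Node) : ZMod 2 := rayCochain a u v + rayCochain b u v

theorem segmentCochain_eq_zero {a b u v : Node} {r : ℕ} (hab : a.2 = b.2) (ha : a ∈ box 0 r)
    (hb : b ∈ box 0 r) (hu : u ∉ box 0 r) (hv : v ∉ box 0 r) : segmentCochain a b u v = 0 := by
  rw [mem_box] at ha hb hu hv
  simp only [Prod.fst_zero, Prod.snd_zero] at ha hb hu hv
  have : rayCochain a u v = rayCochain b u v := by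
    unfold rayCochain
    congr 1
    apply propext
    omega
  rw [segmentCochain, this, zmod_two_add_self]

/-- Infinite `0`paths which start in a box and pass the segment from `a` to `b` on different sides,
as measured by `θ` within the box, cannot coexist with `1*`paths from `a` and from `b` to infinity
that avoid the box. Close a `1*`path from `a` to `b` within the `1*`cluster, and close another one
near infinity, outside the box. The former separates the starting points of the two `0`paths, and
the latter does not; but these starting points are connected within the `0`cluster, off both
closed paths. -/
theorem Coexists.not_both_parities {σ : Config} (h : Coexists σ) {a b c : Node} {m : ℕ}
    (hab : a.2 = b.2) (ha : a ∈ infiniteOneStarCluster σ) (hb : b ∈ infiniteOneStarCluster σ)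
    (hac : Escapes starGraph (filledCluster σ \ box c m) a)
    (hbc : Escapes starGraph (filledCluster σ \ box c m) b) {θ : Node → ZMod 2}
    (hθ : ∀ u v, latticeGraph.Adj u v → u ∈ box c m → v ∈ box c m →
      θ u + θ v = segmentCochain a b u v)
    {x y : Node} (hx : x ∈ box c m) (hy : y ∈ box c m) {i : ZMod 2}
    (hxi : EscapesWithParity (segmentCochain a b) {x | σ x = 0} x (i + θ x))
    (hyi : EscapesWithParity (segmentCochain a b) {x | σ x = 0} y (i + 1 + θ y)) : False := by
  -- the first closed path: within the cluster
  obtain ⟨r, hr⟩ := (h.linked_cluster ha hb).exists_box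
  obtain ⟨f, hf⟩ := exists_potential hr
  obtain ⟨s, hs⟩ := exists_mem_box a
  obtain ⟨t, ht⟩ := exists_mem_box b
  set R := r + s + t with hR
  obtain ⟨u, hu, hxu⟩ := hxi.2 R
  obtain ⟨v, hv, hyv⟩ := hyi.2 R
  have hzero : ∀ u ∈ {x | σ x = 0}, u ∉ infiniteOneStarCluster σ ∩ box 0 r := by
    rintro u hu ⟨huC, -⟩
    have h1 : σ u = 1 := (mem_infiniteOneStarCluster.1 huC).1
    rw [Set.mem_ofPred_eq, h1] at hu
    exact absurd hu (by decide)
  have hfx := potential_of_parityStep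
    (fun u v huv hu hv => hf u v huv (hzero u hu) (hzero v hv)) hxu
  have hfy := potential_of_parityStep
    (fun u v huv hu hv => hf u v huv (hzero u hu) (hzero v hv)) hyv
  have hfuv : f u = f v := by
    refine (linked_compl_box hu hv).apply_eq f fun u v huv hu hv => CharTwo.add_eq_zero.1 ?_
    rw [hf u v huv (fun h => hu (box_mono 0 (by omega) h.2))
      (fun h => hv (box_mono 0 (by omega) h.2))]
    exact segmentCochain_eq_zero hab (box_mono 0 (by omega) hs) (box_mono 0 (by omega) ht) hu hv
  -- the second closed path: along the two infinite paths, and far out from one to the other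
  have hxy : Linked latticeGraph {z | Escapes latticeGraph {x | σ x = 0} z} x y :=
    ((h.linked_zero x y hxi.escapes hyi.escapes).restrict
      (fun u v huv hu hv hu' => hu'.of_linked (Linked.step huv hu hv)) hxi.escapes).1
  obtain ⟨r', hr'⟩ := hxy.exists_box
  obtain ⟨k, hk⟩ := exists_subset_box (finite_box c m)
  obtain ⟨a', ha', haa'⟩ := hac.2 (r' + k)
  obtain ⟨b', hb', hbb'⟩ := hbc.2 (r' + k)
  have hpath : Linked starGraph (filledCluster σ \ box c m ∪ (box 0 (r' + k))ᶜ) a b :=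
    (haa'.mono Set.subset_union_left).trans
      (((linked_compl_box ha' hb').toStar.mono Set.subset_union_right).trans
        (hbb'.mono Set.subset_union_left).symm)
  obtain ⟨g, hg⟩ := exists_potential hpath
  have hfg : f x + g x = f y + g y := by
    refine hr'.apply_eq (fun z => f z + g z) fun u v huv hu hv => CharTwo.add_eq_zero.1 ?_
    have hoff : ∀ z ∈ {z | Escapes latticeGraph {x | σ x = 0} z} ∩ box 0 r',
        z ∉ filledCluster σ \ box c m ∪ (box 0 (r' + k))ᶜ := by
      rintro z ⟨hz, hz'⟩ (h | h)
      · exact not_mem_filledCluster_of_escapes hz h.1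
      · exact h (box_mono 0 (by omega) hz')
    have h1 := hf u v huv (hzero u hu.1.1) (hzero v hv.1.1)
    have h2 := hg u v huv (hoff u hu) (hoff v hv)
    linear_combination h1 + h2 + zmod_two_add_self (rayCochain a u v + rayCochain b u v)
  have hgθ : g x + θ x = g y + θ y := by
    refine (linked_box hx hy).apply_eq (fun z => g z + θ z)
      fun u v huv hu hv => CharTwo.add_eq_zero.1 ?_
    have hoff : ∀ z ∈ box c m, z ∉ filledCluster σ \ box c m ∪ (box 0 (r' + k))ᶜ := by
      rintro z hz (h | h)
      · exact h.2 hz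
      · exact h (box_mono 0 (by omega) (hk hz))
    have h1 := hθ u v huv hu hv
    have h2 := hg u v huv (hoff u hu) (hoff v hv)
    rw [segmentCochain] at h1
    linear_combination h1 + h2 + zmod_two_add_self (rayCochain a u v + rayCochain b u v)
  simp only [add_zero] at hfx hfy
  have : (1 : ZMod 2) = 0 := by
    linear_combination hfy - hfx + hfg - hgθ + hfuv + zmod_two_add_self (1 + f v - f u)
  exact absurd this (by decide)

/-! ### Monodromy around an end of the segment -/

/-- If at each time at least one parity is possible, and opposite parities are never possible at
consecutive times, then a parity persists. -/
theorem propagate {Q : ℕ → ZMod 2 → Prop} {N : ℕ} {i : ZMod 2} (htot : ∀ t, Q t 0 ∨ Q t 1)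
    (hex : ∀ t < N, ¬ (Q t i ∧ Q (t + 1) (i + 1))) (h : Q 0 i) : Q N i := by
  induction N with
  | zero => exact h
  | succ N ih =>
    have hN := ih fun t ht => hex t (by omega)
    have hcases : ∀ i : ZMod 2, (i = 0 ∧ i + 1 = 1) ∨ (i = 1 ∧ i + 1 = 0) := by decide
    rcases hcases i with ⟨h0, h1⟩ | ⟨h0, h1⟩ <;> rcases htot (N + 1) with h' | h'
    · rwa [h0]
    · exact absurd ⟨hN, by rwa [h1]⟩ (hex N (by omega))
    · exact absurd ⟨hN, by rwa [h1]⟩ (hex N (by omega))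
    · rwa [h0]

/-- A choice, for every box of radius `n`, of a parity relative to local gauges `θ` with coboundary
`ω` cannot be consistent for all neighbouring boxes at distance more than `R` from the ends `0` and
`b` of the segment: a box which is moved once around the end `0` passes the segment once, so that the
parity would have to change. -/
theorem not_consistent_parity {n R : ℕ} (hR : n + 1 ≤ R) {b : Node} (hb : b = (3 * ((R : ℤ) + 1), (0 : ℤ)))
    {Q : Node → (Node → ZMod 2) → ZMod 2 → Prop} (htot : ∀ c θ, Q c θ 0 ∨ Q c θ 1)
    (hcongr : ∀ c θ θ' i j, (∀ x ∈ box c n, i + θ x = j + θ' x) → Q c θ i → Q c θ' j)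
    (hex : ∀ c c' θ i, 0 ∉ box c R → b ∉ box c R → (c' = c ∨ latticeGraph.Adj c c') →
      (∀ u v, latticeGraph.Adj u v → u ∈ box c (n + 1) → v ∈ box c (n + 1) →
        θ u + θ v = segmentCochain 0 b u v) → ¬ (Q c θ i ∧ Q c' θ (i + 1))) : False := by
  classical
  subst hb
  set ρ : ℤ := R + 1 with hρ
  -- the gauge for the part of the way around `0` that passes the segment
  set θ : Node → ZMod 2 := fun u => if 1 ≤ u.2 then 1 else 0 with hθ
  have hgauge0 : ∀ t : ℤ, ∀ u v, latticeGraph.Adj u v → u ∈ box (-ρ, t) (n + 1) →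
      v ∈ box (-ρ, t) (n + 1) → (0 : Node → ZMod 2) u + (0 : Node → ZMod 2) v =
        segmentCochain 0 (3 * ρ, 0) u v := by
    intro t u v huv hu hv
    rw [mem_box] at hu hv
    push_cast at hu hv
    have h1 : rayCochain 0 u v = 0 := if_neg (by simp only [Prod.fst_zero]; omega)
    have h2 : rayCochain (3 * ρ, 0) u v = 0 := if_neg (by simp only; omega)
    rw [segmentCochain, h1, h2]
    rfl
  have hgauge : ∀ c : Node, (c.2 = ρ ∨ c.2 = -ρ ∨ c.1 = ρ) → ∀ u v, latticeGraph.Adj u v →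
      u ∈ box c (n + 1) → v ∈ box c (n + 1) → θ u + θ v = segmentCochain 0 (3 * ρ, 0) u v := by
    intro c hc u v huv hu hv
    rw [mem_box] at hu hv
    push_cast at hu hv
    rw [latticeGraph_adj_iff] at huv
    simp only [hθ, segmentCochain, rayCochain, Prod.fst_zero, Prod.snd_zero]
    split_ifs <;> first | rfl | (exfalso; omega)
  have hfar : ∀ c : Node, (c.2 = ρ ∨ c.2 = -ρ ∨ c.1 = ρ ∨ c.1 = -ρ) → c.1 ≤ ρ →
      0 ∉ box c R ∧ ((3 * ρ, 0) : Node) ∉ box c R := by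
    intro c hc hc1
    rw [mem_box, mem_box]
    simp only [Prod.fst_zero, Prod.snd_zero]
    omega
  obtain ⟨i, hi⟩ : ∃ i, Q (-ρ, ρ) 0 i := (htot (-ρ, ρ) 0).elim (fun h => ⟨0, h⟩) fun h => ⟨1, h⟩
  -- down the left side, where the gauge `0` is valid
  have hleft : Q (-ρ, -ρ) 0 i := by
    have := propagate (Q := fun t => Q (-ρ, ρ - t) 0) (N := 2 * (R + 1)) (i := i)
      (fun t => htot _ _) (fun t ht => hex _ _ 0 i (hfar _ (by simp) (by simp; omega)).1
        (hfar _ (by simp) (by simp; omega)).2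
        (Or.inr (latticeGraph_adj_iff.2 (Or.inr ⟨rfl, Or.inr (by push_cast; ring)⟩)))
        (hgauge0 _)) (by simpa using hi)
    convert this using 2
    push_cast
    omega
  -- along the top, down the right side, and back along the bottom
  have htop0 : Q (-ρ, ρ) θ (i + 1) := by
    refine hcongr _ _ _ _ _ (fun x hx => ?_) hi
    rw [mem_box] at hx
    have : θ x = 1 := if_pos (by simp only at hx; omega)
    rw [this, Pi.zero_apply]
    linear_combination -zmod_two_add_self (1 : ZMod 2)
  have htop : Q (ρ, ρ) θ (i + 1) := by
    have := propagate (Q := fun t => Q (-ρ + t, ρ) θ) (N := 2 * (R + 1)) (i := i + 1)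
      (fun t => htot _ _) (fun t ht => hex _ _ θ _ (hfar _ (by simp) (by simp only; omega)).1
        (hfar _ (by simp) (by simp only; omega)).2
        (Or.inr (latticeGraph_adj_iff.2 (Or.inl ⟨rfl, Or.inl (by push_cast; ring)⟩)))
        (hgauge _ (by simp))) (by simpa using htop0)
    convert this using 2
    push_cast
    omega
  have hright : Q (ρ, -ρ) θ (i + 1) := by
    have := propagate (Q := fun t => Q (ρ, ρ - t) θ) (N := 2 * (R + 1)) (i := i + 1)
      (fun t => htot _ _) (fun t ht => hex _ _ θ _ (hfar _ (by simp) (by simp)).1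
        (hfar _ (by simp) (by simp)).2
        (Or.inr (latticeGraph_adj_iff.2 (Or.inr ⟨rfl, Or.inr (by push_cast; ring)⟩)))
        (hgauge _ (by simp))) (by simpa using htop)
    convert this using 2
    push_cast
    omega
  have hbottom : Q (-ρ, -ρ) θ (i + 1) := by
    have := propagate (Q := fun t => Q (ρ - t, -ρ) θ) (N := 2 * (R + 1)) (i := i + 1)
      (fun t => htot _ _) (fun t ht => hex _ _ θ _ (hfar _ (by simp) (by simp only; omega)).1
        (hfar _ (by simp) (by simp only; omega)).2
        (Or.inr (latticeGraph_adj_iff.2 (Or.inl ⟨rfl, Or.inr (by push_cast; ring)⟩)))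
        (hgauge _ (by simp))) (by simpa using hright)
    convert this using 2
    push_cast
    omega
  have hleft' : Q (-ρ, -ρ) θ i := by
    refine hcongr _ _ _ _ _ (fun x hx => ?_) hleft
    rw [mem_box] at hx
    have : θ x = 0 := if_neg (by simp only at hx; omega)
    rw [this]
    rfl
  exact hex (-ρ, -ρ) (-ρ, -ρ) θ i (hfar _ (by simp) (by simp only; omega)).1
    (hfar _ (by simp) (by simp only; omega)).2 (Or.inl rfl) (hgauge _ (by simp))
    ⟨hleft', hbottom⟩

/-! ### Probability estimates -/

theorem measurableSet_mem_infiniteOneStarCluster (x : Node) :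
    MeasurableSet {σ : Config | x ∈ infiniteOneStarCluster σ} := by
  simp only [mem_infiniteOneStarCluster]
  exact measurableSet_escapes starGraph (measurableSet_spin 1) x

theorem measurable_filledCluster : Measurable filledCluster := by
  rw [measurable_set_iff]
  intro x
  apply measurableSet_setOfPred.1
  have hC := measurableSet_mem_infiniteOneStarCluster
  have heq : {σ | x ∈ filledCluster σ} = {σ | x ∈ infiniteOneStarCluster σ} ∪
      {σ | Escapes latticeGraph (infiniteOneStarCluster σ)ᶜ x}ᶜ := by
    ext σ
    by_cases hx : x ∈ infiniteOneStarCluster σ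
    · simp [hx, infiniteOneStarCluster_subset σ hx]
    · simp [hx, mem_filledCluster_iff hx, escapes_iff_infinite (A := (infiniteOneStarCluster σ)ᶜ) hx]
  rw [heq]
  exact (hC x).union (measurableSet_escapes latticeGraph (fun y => (hC y).compl) x).compl

theorem setOf_eq_one_subset {σ τ : Config} (h : σ ≤ τ) : {x | σ x = 1} ⊆ {x | τ x = 1} := by
  intro x hx
  have key : ∀ i j : Fin 2, i ≤ j → i = 1 → j = 1 := by decide
  exact key _ _ (h x) hx

theorem setOf_eq_zero_subset {σ τ : Config} (h : σ ≤ τ) : {x | τ x = 0} ⊆ {x | σ x = 0} := by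
  intro x hx
  have key : ∀ i j : Fin 2, i ≤ j → j = 0 → i = 0 := by decide
  exact key _ _ (h x) hx

theorem exists_measureReal_le {Ω : Type*} [MeasurableSpace Ω] (P : Measure Ω) [IsFiniteMeasure P]
    {S : ℕ → Set Ω} (hS : ∀ n, MeasurableSet (S n)) (hanti : Antitone S)
    (hae : ∀ᵐ ω ∂P, ∃ n, ω ∉ S n) {ε : ℝ} (hε : 0 < ε) : ∃ n, P.real (S n) ≤ ε := by
  have h0 : P (⋂ n, S n) = 0 := by
    refine measure_mono_null (fun ω hω => ?_) (ae_iff.1 hae)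
    rintro ⟨n, hn⟩
    exact hn (Set.mem_iInter.1 hω n)
  have hlim := tendsto_measure_iInter_atTop (μ := P) (fun n => (hS n).nullMeasurableSet) hanti
    ⟨0, measure_ne_top P _⟩
  rw [h0] at hlim
  obtain ⟨n, hn⟩ := (hlim.eventually_lt_const (ENNReal.ofReal_pos.2 hε)).exists
  exact ⟨n, ENNReal.toReal_le_of_le_ofReal hε.le hn.le⟩

section Stationary

variable {μ : Measure Config}

theorem measureReal_filledCluster_translate (hinv : BoundaryLawTranslationInvariant μ)
    (hco : ∀ᵐ σ ∂μ[|coexistence], Coexists σ) (v : Node)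
    {𝒮 : Set (Set Node)} (h𝒮 : MeasurableSet 𝒮) :
    (μ[|coexistence]).real {σ | {x | x + v ∈ filledCluster σ} ∈ 𝒮} =
      (μ[|coexistence]).real {σ | filledCluster σ ∈ 𝒮} :=
  congrArg ENNReal.toReal (measure_filledCluster_translate hinv hco v h𝒮)

theorem measurableSet_mem_node (x : Node) : MeasurableSet {W : Set Node | x ∈ W} :=
  measurableSet_setOfPred.2 (measurable_set_mem x)

/-- All nodes belong to the infinite `1*`cluster with probability bounded away from zero: the boundary
nodes of the filled cluster belong to it, and they form a stationary set. -/
theorem exists_le_measureReal_mem_cluster [IsFiniteMeasure μ] (hne : μ coexistence ≠ 0)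
    (hinv : BoundaryLawTranslationInvariant μ) (hco : ∀ᵐ σ ∂μ[|coexistence], Coexists σ) :
    ∃ q : ℝ, 0 < q ∧ ∀ c, q ≤ (μ[|coexistence]).real {σ | c ∈ infiniteOneStarCluster σ} := by
  have := cond_isProbabilityMeasure hne
  -- `𝒮` is the event that the origin is a boundary node of the set
  set 𝒮 : Set (Set Node) := {W | 0 ∈ W ∧ ∃ y, latticeGraph.Adj 0 y ∧ y ∉ W} with h𝒮
  have hmeas : MeasurableSet 𝒮 := by
    have : 𝒮 = {W : Set Node | 0 ∈ W} ∩
        ⋃ y, {_W | latticeGraph.Adj 0 y} ∩ {W : Set Node | y ∈ W}ᶜ := by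
      ext W
      simp [h𝒮]
    rw [this]
    exact (measurableSet_mem_node 0).inter (MeasurableSet.iUnion fun y =>
      (MeasurableSet.const _).inter (measurableSet_mem_node y).compl)
  have htrans := fun c => measureReal_filledCluster_translate hinv hco c hmeas
  refine ⟨(μ[|coexistence]).real {σ | filledCluster σ ∈ 𝒮}, ?_, fun c => ?_⟩
  · refine lt_of_le_of_ne measureReal_nonneg fun h0 => ?_
    have hnone : ∀ᵐ σ ∂μ[|coexistence], ∀ c, {x | x + c ∈ filledCluster σ} ∉ 𝒮 := by
      rw [ae_all_iff]
      intro c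
      rw [ae_iff]
      simp only [not_not]
      rw [← measureReal_eq_zero_iff, htrans c]
      exact h0.symm
    obtain ⟨σ, hσ, hσ'⟩ := (hnone.and hco).exists
    obtain ⟨x, y, hxy, hx, hy⟩ := hσ'.exists_boundary
    refine hσ x ⟨?_, y - x, ?_, ?_⟩
    · simpa using hx
    · have := (latticeGraph_adj_add (x := 0) (y := y - x) x)
      rwa [zero_add, sub_add_cancel, iff_true_left hxy] at this
    · simpa using hy
  · rw [← htrans c]
    refine measureReal_mono ?_
    rintro σ ⟨h0, y, hy, hyW⟩
    have h0' : c ∈ filledCluster σ := by simpa using h0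
    refine mem_infiniteOneStarCluster_of_boundary h0' hyW ?_
    simpa using (latticeGraph_adj_add c).2 hy

/-- Large boxes meet the infinite `0`cluster with high probability, uniformly in their position,
because they meet the boundary of the filled cluster. -/
theorem exists_box_infiniteZeroCluster [IsFiniteMeasure μ] (hne : μ coexistence ≠ 0)
    (hinv : BoundaryLawTranslationInvariant μ) (hco : ∀ᵐ σ ∂μ[|coexistence], Coexists σ)
    {ε : ℝ} (hε : 0 < ε) : ∃ n, ∀ c, (μ[|coexistence]).real
      {σ | ∀ x ∈ box c n, ¬ Escapes latticeGraph {x | σ x = 0} x} ≤ ε := by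
  have := cond_isProbabilityMeasure hne
  -- `𝒮 n` is the event that the set has no boundary in the box of radius `n`
  set 𝒮 : ℕ → Set (Set Node) := fun n =>
    {W | ∀ x y, x ∈ box 0 n → latticeGraph.Adj x y → x ∈ W → y ∈ W} with h𝒮
  have hmeas : ∀ n, MeasurableSet (𝒮 n) := by
    intro n
    have : 𝒮 n = ⋂ x, ⋂ y, ({_W | x ∈ box 0 n ∧ latticeGraph.Adj x y} ∩
        ({W : Set Node | x ∈ W} ∩ {W : Set Node | y ∈ W}ᶜ))ᶜ := by
      ext W
      simp [h𝒮]
    rw [this]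
    exact MeasurableSet.iInter fun x => MeasurableSet.iInter fun y => ((MeasurableSet.const _).inter
      ((measurableSet_mem_node x).inter (measurableSet_mem_node y).compl)).compl
  obtain ⟨n, hn⟩ := exists_measureReal_le μ[|coexistence]
    (S := fun n => {σ | filledCluster σ ∈ 𝒮 n}) (fun n => measurable_filledCluster (hmeas n))
    (fun n k hnk σ hσ x y hx => hσ x y (box_mono 0 hnk hx)) (by
      filter_upwards [hco] with σ hσ
      obtain ⟨x, y, hxy, hx, hy⟩ := hσ.exists_boundary
      obtain ⟨n, hn⟩ := exists_mem_box x
      exact ⟨n, fun h => hy (h x y hn hxy hx)⟩) hε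
  refine ⟨n + 1, fun c => le_trans (measureReal_mono ?_)
    ((measureReal_filledCluster_translate hinv hco c (hmeas n)).trans_le hn)⟩
  intro σ hσ x y hx hxy hxW
  by_contra hyW
  refine hσ (y + c) ?_ (escapes_of_boundary hxW hyW ((latticeGraph_adj_add c).2 hxy))
  rw [latticeGraph_adj_iff] at hxy
  rw [mem_box] at hx ⊢
  simp only [Prod.fst_add, Prod.snd_add, Prod.fst_zero, Prod.snd_zero] at hx ⊢
  push_cast
  omega

/-- It is unlikely, uniformly in the position of a box, that its removal cuts off from infinity a node
of the filled cluster which is far from the box. -/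
theorem exists_radius_cutOff [IsFiniteMeasure μ] (hne : μ coexistence ≠ 0)
    (hinv : BoundaryLawTranslationInvariant μ) (hco : ∀ᵐ σ ∂μ[|coexistence], Coexists σ)
    (m : ℕ) {ε : ℝ} (hε : 0 < ε) : ∃ R, m ≤ R ∧ ∀ c, (μ[|coexistence]).real
      {σ | ∃ x, x ∉ box c R ∧ x ∈ filledCluster σ \ box c m ∧
        ¬ Escapes starGraph (filledCluster σ \ box c m) x} ≤ ε := by
  have := cond_isProbabilityMeasure hne
  obtain ⟨R, hR⟩ := exists_measureReal_le μ[|coexistence]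
    (S := fun R => {σ | filledCluster σ ∈ cutOff m R})
    (fun R => measurable_filledCluster (measurableSet_cutOff m R))
    (fun R R' hRR σ ⟨x, hx, hx'⟩ => ⟨x, fun h => hx (box_mono 0 hRR h), hx'⟩) (by
      filter_upwards [hco] with σ hσ
      exact exists_notMem_cutOff hσ.infinite_filledCluster
        (fun x hx y hy => hσ.linked_filledCluster hx hy) m) hε
  refine ⟨max m R, le_max_left _ _, fun c => le_trans (measureReal_mono ?_)
    ((measureReal_filledCluster_translate hinv hco c (measurableSet_cutOff m R)).trans_le hR)⟩
  rintro σ ⟨x, hxR, ⟨hxW, hxm⟩, hx⟩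
  have hbox : ∀ k : ℕ, x - c ∈ box 0 k → x ∈ box c k := by
    intro k h
    rw [mem_box] at h ⊢
    simp only [Prod.fst_sub, Prod.snd_sub, Prod.fst_zero, Prod.snd_zero] at h
    omega
  refine ⟨x - c, fun h => hxR (box_mono c (le_max_right _ _) (hbox R h)),
    ⟨by simpa using hxW, fun h => hxm (hbox m h)⟩, fun h => hx ?_⟩
  simpa using escapes_of_translate h

end Stationary

end SitePercolation

theorem theorem2 :
    ¬ ∃ μ : Measure Config,
      IsProbabilityMeasure μ ∧
      PositivelyAssociated μ ∧
      (∀ᵐ σ ∂μ, ∃! S, IsInfiniteZeroCluster σ S) ∧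
      (∀ᵐ σ ∂μ, ∀ S T, IsInfiniteOneStarCluster σ S → IsInfiniteOneStarCluster σ T → S = T) ∧
      BoundaryLawTranslationInvariant μ ∧
      0 < μ {σ | ∃ S, IsInfiniteOneStarCluster σ S} := by
  rintro ⟨μ, hprob, hpos, h0, h1, hinv, hpositive⟩
  simp only [exists_infiniteOneStarCluster_iff] at hpositive
  set E : Set Config := {σ | ∃ x, Escapes starGraph {x | σ x = 1} x} with hE
  have hEmeas : MeasurableSet E := by
    have : E = ⋃ x, {σ : Config | Escapes starGraph {x | σ x = 1} x} := by
      ext σ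
      simp [hE]
    rw [this]
    exact MeasurableSet.iUnion (measurableSet_escapes starGraph (measurableSet_spin 1))
  have hEupper : IsUpperSet E := fun σ τ h ⟨x, hx⟩ => ⟨x, hx.mono (setOf_eq_one_subset h)⟩
  have hae : ∀ᵐ σ ∂μ, σ ∈ E → Coexists σ := by
    filter_upwards [h0, h1] with σ h0 h1 h2
    exact coexists_of_unique h0 h1 h2
  have hcoE : coexistence =ᵐ[μ] E := by
    filter_upwards [h0, h1] with σ h0 h1
    apply propext
    constructor
    · rintro ⟨-, h⟩
      exact exists_infiniteOneStarCluster_iff.1 h.exists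
    · intro h
      obtain ⟨S, hS⟩ := exists_infiniteOneStarCluster_iff.2 h
      exact ⟨h0, S, hS, fun T hT => h1 T S hT hS⟩
  have hcond : μ[|coexistence] = μ[|E] := by
    rw [ProbabilityTheory.cond, ProbabilityTheory.cond, measure_congr hcoE,
      Measure.restrict_congr_set hcoE]
  have hne : μ coexistence ≠ 0 := by
    rw [measure_congr hcoE]
    exact hpositive.ne'
  have hco : ∀ᵐ σ ∂μ[|coexistence], Coexists σ := by
    rw [hcond]
    filter_upwards [ae_cond_mem hEmeas, cond_absolutelyContinuous.ae_le hae] with σ h1 h2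
    exact h2 h1
  have hfkg : ∀ A B : Set Config, MeasurableSet A → MeasurableSet B → IsUpperSet A → IsUpperSet B →
      μ.real A * μ.real B ≤ μ.real (A ∩ B) := by
    intro A B hA hB hA' hB'
    rw [measureReal_def, measureReal_def, ← ENNReal.toReal_mul]
    exact ENNReal.toReal_mono (measure_ne_top μ _) (hpos A B hA hB hA' hB')
  set p := μ.real E with hp
  have hp0 : 0 < p := ENNReal.toReal_pos hpositive.ne' (measure_ne_top μ _)
  have hmul : ∀ t, (μ[|coexistence]).real t * p = μ.real (E ∩ t) := by
    intro t
    rw [hcond, hp, measureReal_def, measureReal_def, ← ENNReal.toReal_mul,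
      cond_mul_eq_inter hEmeas, measureReal_def]
  have hp1 : p ≤ 1 := measureReal_le_one
  -- every node belongs to the infinite `1*`cluster with probability at least `δ`
  obtain ⟨q, hq0, hq⟩ := exists_le_measureReal_mem_cluster hne hinv hco
  set δ := q * p with hδ
  have hδ0 : 0 < δ := mul_pos hq0 hp0
  have hone : ∀ c, δ ≤ μ.real {σ | c ∈ infiniteOneStarCluster σ} := fun c =>
    ((mul_le_mul_of_nonneg_right (hq c) hp0.le).trans_eq (hmul _)).trans
      (measureReal_mono Set.inter_subset_right)
  set ε := δ * δ / 4 with hε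
  have hε0 : 0 < ε := by positivity
  obtain ⟨n, hn⟩ := exists_box_infiniteZeroCluster hne hinv hco (mul_pos hε0 hε0)
  obtain ⟨R, hnR, hR⟩ := exists_radius_cutOff hne hinv hco (n + 1) hε0
  -- the infinite `0`cluster misses a box with small probability even unconditionally, since
  -- conditioning on the increasing event `E` makes this increasing event more likely
  have hmiss : ∀ c, μ.real {σ | ∀ x ∈ box c n, ¬ Escapes latticeGraph {x | σ x = 0} x} ≤ ε * ε := by
    intro c
    refine le_trans ?_ (hn c)
    have h := hfkg E {σ | ∀ x ∈ box c n, ¬ Escapes latticeGraph {x | σ x = 0} x} hEmeas ?_ hEupper ?_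
    · rw [← hmul, mul_comm] at h
      exact le_of_mul_le_mul_right h hp0
    · have : {σ : Config | ∀ x ∈ box c n, ¬ Escapes latticeGraph {x | σ x = 0} x} =
          ⋂ x, ({_σ | x ∈ box c n} ∩ {σ : Config | Escapes latticeGraph {x | σ x = 0} x})ᶜ := by
        ext σ
        simp
      rw [this]
      exact MeasurableSet.iInter fun x => ((MeasurableSet.const _).inter
        (measurableSet_escapes latticeGraph (measurableSet_spin 0) x)).compl
    · intro σ τ h hσ x hx hE
      exact hσ x hx (hE.mono (setOf_eq_zero_subset h))
  set b : Node := (3 * ((R : ℤ) + 1), (0 : ℤ)) with hb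
  set ω := segmentCochain 0 b
  -- `F c θ i`: no infinite `0`path of parity `i`, relative to the gauge `θ`, starts in the box at `c`
  set F : Node → (Node → ZMod 2) → ZMod 2 → Set Config := fun c θ i =>
    {σ | ∀ x ∈ box c n, ¬ EscapesWithParity ω {x | σ x = 0} x (i + θ x)} with hF
  have hFmeas : ∀ c θ i, MeasurableSet (F c θ i) := by
    intro c θ i
    have : F c θ i = ⋂ x, ({_σ | x ∈ box c n} ∩
        {σ : Config | EscapesWithParity ω {x | σ x = 0} x (i + θ x)})ᶜ := by
      ext σ
      simp [hF]
    rw [this]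
    exact MeasurableSet.iInter fun x => ((MeasurableSet.const _).inter
      (measurableSet_escapesWithParity ω x _)).compl
  have hFupper : ∀ c θ i, IsUpperSet (F c θ i) := fun c θ i σ τ h hσ x hx hE =>
    hσ x hx (hE.mono (setOf_eq_zero_subset h))
  refine not_consistent_parity (Q := fun c θ i => μ.real (F c θ i) ≤ ε) hnR hb ?_ ?_ ?_
  · -- the square root trick
    intro c θ
    by_contra! hcon
    have hsub : F c θ 0 ∩ F c θ 1 ⊆
        {σ | ∀ x ∈ box c n, ¬ Escapes latticeGraph {x | σ x = 0} x} := by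
      rintro σ ⟨hσ0, hσ1⟩ x hx hE
      have key : ∀ i : ZMod 2, (0 + i = 0 ∧ 1 + i = 1) ∨ (0 + i = 1 ∧ 1 + i = 0) := by decide
      have hx0 := hσ0 x hx
      have hx1 := hσ1 x hx
      rcases key (θ x) with ⟨h0, h1⟩ | ⟨h0, h1⟩ <;> rw [h0] at hx0 <;> rw [h1] at hx1
      · exact (hE.exists_parity ω).elim hx0 hx1
      · exact (hE.exists_parity ω).elim hx1 hx0
    have h := (hfkg _ _ (hFmeas c θ 0) (hFmeas c θ 1) (hFupper c θ 0) (hFupper c θ 1)).trans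
      ((measureReal_mono hsub).trans (hmiss c))
    exact absurd h (not_le.2 (mul_lt_mul'' hcon.1 hcon.2 hε0.le hε0.le))
  · intro c θ θ' i j hθ hQ
    refine (measureReal_mono fun σ hσ x hx => ?_).trans hQ
    rw [hθ x hx]
    exact hσ x hx
  · -- with probability at least `δ * δ - 3 * ε > 0` both parities occur in neighbouring boxes, and
    -- `0` and `b` belong to the infinite `1*`cluster and are not cut off by the boxes
    rintro c c' θ i h0R hbR hcc hθ ⟨hQ, hQ'⟩
    have hboth : δ * δ ≤ μ.real ({σ | 0 ∈ infiniteOneStarCluster σ} ∩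
        {σ | b ∈ infiniteOneStarCluster σ}) := by
      refine (mul_le_mul (hone 0) (hone b) hδ0.le measureReal_nonneg).trans
        (hfkg _ _ (measurableSet_mem_infiniteOneStarCluster 0)
          (measurableSet_mem_infiniteOneStarCluster b) ?_ ?_)
      all_goals
        intro σ τ h hσ
        rw [Set.mem_ofPred_eq, mem_infiniteOneStarCluster] at hσ ⊢
        exact hσ.mono (setOf_eq_one_subset h)
    have hnull : μ.real {σ | ¬ (σ ∈ E → Coexists σ)} = 0 := by
      rw [measureReal_eq_zero_iff]
      exact ae_iff.1 hae
    have hcut := mul_le_mul_of_nonneg_right (hR c) hp0.le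
    rw [hmul] at hcut
    set cut : Set Config := {σ | ∃ x, x ∉ box c R ∧ x ∈ filledCluster σ \ box c (n + 1) ∧
        ¬ Escapes starGraph (filledCluster σ \ box c (n + 1)) x}
    have hsub : {σ | 0 ∈ infiniteOneStarCluster σ} ∩ {σ | b ∈ infiniteOneStarCluster σ} ⊆
        (F c θ i ∪ F c' θ (i + 1)) ∪ (E ∩ cut ∪ {σ | ¬ (σ ∈ E → Coexists σ)}) := by
      rintro σ ⟨ha, hbσ⟩
      change 0 ∈ infiniteOneStarCluster σ at ha
      change b ∈ infiniteOneStarCluster σ at hbσ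
      by_contra hcon
      simp only [Set.mem_union, not_or] at hcon
      obtain ⟨⟨hF1, hF2⟩, hncut, hgood⟩ := hcon
      have hσE : σ ∈ E := ⟨0, mem_infiniteOneStarCluster.1 ha⟩
      have hσ : Coexists σ := not_not.1 hgood hσE
      have hesc : ∀ a, a ∈ infiniteOneStarCluster σ → a ∉ box c R →
          Escapes starGraph (filledCluster σ \ box c (n + 1)) a := by
        intro a haC haR
        by_contra hne
        exact hncut ⟨hσE, a, haR, ⟨infiniteOneStarCluster_subset σ haC,
          fun h => haR (box_mono c hnR h)⟩, hne⟩
      simp only [hF, Set.mem_ofPred_eq, not_forall, not_not] at hF1 hF2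
      obtain ⟨x, hx, hxi⟩ := hF1
      obtain ⟨y, hy, hyi⟩ := hF2
      refine hσ.not_both_parities (a := 0) (b := b) (c := c) (m := n + 1) rfl ha hbσ
        (hesc 0 ha h0R) (hesc b hbσ hbR) hθ (box_mono c (by omega) hx) ?_ hxi hyi
      rcases hcc with rfl | hcc
      · exact box_mono c' (by omega) hy
      · rw [latticeGraph_adj_iff] at hcc
        rw [mem_box] at hy ⊢
        push_cast
        omega
    have h1 := measureReal_mono (μ := μ) hsub
    have h2 := measureReal_union_le (μ := μ) (F c θ i ∪ F c' θ (i + 1))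
      (E ∩ cut ∪ {σ | ¬ (σ ∈ E → Coexists σ)})
    have h3 := measureReal_union_le (μ := μ) (F c θ i) (F c' θ (i + 1))
    have h4 := measureReal_union_le (μ := μ) (E ∩ cut) {σ | ¬ (σ ∈ E → Coexists σ)}
    have h5 : ε * p ≤ ε := mul_le_of_le_one_right hε0.le hp1
    have h6 : δ * δ = 4 * ε := by rw [hε]; ring
    linarith
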